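/- Let $p\ge 0$ be an integer and let $\Xi=(\xi_1\le\dots\le\xi_{n+p+1})$ be a $(p+1)$-basic knot vector on $[a,b]$: $n\ge p+1$, $\xi_{p+1}=a<\xi_{p+2}$, $\xi_n<\xi_{n+1}=b$, and each interior breakpoint (each value among the interior knots $\xi_{p+2},\dots,\xi_n$) has multiplicity at most $p+1$. Let $B_1,\dots,B_n$ be the associated B-splines of degree $p$ and $\mathbb S$ the spline space they span on $[a,b]$. For $s=\sum_{i=1}^n c_iB_i\in\mathbb S$ put $$\|s\|_\Xi:=\Big(\sum_{i=1}^n c_i^2\,\frac{\xi_{i+p+1}-\xi_i}{p+1}\Big)^{1/2}.$$ For an interior breakpoint $\zeta$ of $\Xi$ with multiplicity $m$, let $i_0$ be the index of the last knot equal to $\zeta$, put $\ell=m-1$ and $\Xi\setminus\{\xi_{i_0}\}=(\xi_1,\dots,\xi_{i_0-1},\xi_{i_0+1},\dots,\xi_{n+p+1})$, and define the indicator $$\mathbb E_{\Xi,\zeta}(s):=\min_{g}\|g-s\|_\Xi ,$$ where $g$ ranges over the spline space of $\Xi\setminus\{\xi_{i_0}\}$. For $1\le j\le p+2-\ell$ let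 $$\alpha_j=\frac{\xi_{i_0}-\xi_{i_0-p-2+j}}{\xi_{i_0-1+j}-\xi_{i_0-p-2+j}},\qquad e_j=\Big(\frac{\xi_{i_0-1+j}-\xi_{i_0-p-2+j}}{p+1}\Big)^{1/2},$$ let $A_{\rm loc}$ be the $(p+2-\ell)\times(p+1-\ell)$ matrix with entries $(A_{\rm loc})_{j,j}=\alpha_j$, $(A_{\rm loc})_{j+1,j}=1-\alpha_{j+1}$ and zeros elsewhere, and let $E_{\rm loc}=\operatorname{diag}(e_1,\dots,e_{p+2-\ell})$. Let $s=\sum_{i=1}^n c_iB_i\in\mathbb S$ and $\mathrm{TOL}>0$, and consider the following adaptive knot-removal algorithm. Start with $k=0$, $\Xi^{(0)}=\Xi$, ${\bf c}^{(0)}={\bf c}$, $\tau_0=\mathrm{TOL}$, and let $k_{\max}=n-p-1$ be the number of interior knots of $\Xi$. Let $s_k$ be the spline with knot vector $\Xi^{(k)}$ and control points ${\bf c}^{(k)}$. As long as $k<k_{\max}$ and $\varepsilon^{(k)}:=\min_{\zeta}\mathbb E_{\Xi^{(k)},\zeta}(s_k)<\tau_k$ (minimum over the interior breakpoints of $\Xi^{(k)}$),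 do the following: 1. choose an interior breakpoint $\zeta$ at which the minimum is attained, with $i_0,\ell,A_{\rm loc},E_{\rm loc}$ formed from $\Xi^{(k)}$, and set $\tau_{k+1}=\tau_k-\varepsilon^{(k)}$; 2. let ${\bf x}\in\mathbb R^{p+1-\ell}$ be the least squares solution of $E_{\rm loc}A_{\rm loc}{\bf x}=E_{\rm loc}\,(c^{(k)}_{i_0-p-1},\dots,c^{(k)}_{i_0-\ell})^T$; 3. set $c^{(k+1)}_i=c^{(k)}_i$ for $i\le i_0-p-2$, $(c^{(k+1)}_{i_0-p-1},\dots,c^{(k+1)}_{i_0-\ell-1})={\bf x}^T$, $c^{(k+1)}_i=c^{(k)}_{i+1}$ for $i\ge i_0-\ell$, and $\Xi^{(k+1)}=\Xi^{(k)}\setminus\{\xi^{(k)}_{i_0}\}$; increase $k$ by one. When the loop ends, return $\hat\Xi=\Xi^{(k)}$ and $\hat{\bf c}={\bf c}^{(k)}$. Then, whichever minimizers are chosen, the algorithm can always be carried out and terminates after finitely many iterations, namely after some $K\le k_{\max}$ of them. Its output $\hat\Xi$ is a $(p+1)$-basic knot vector on $[a,b]$ with $n-K+p+1$ knots, its spline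 space $\hat{\mathbb S}$ satisfies $\hat{\mathbb S}\subseteq\mathbb S$, and the spline $\hat s\in\hat{\mathbb S}$ with control points $\hat{\bf c}$ satisfies $$\|s-\hat s\|_{L^2[a,b]}\le\|s-\hat s\|_\Xi<\mathrm{TOL}.$$ -/

import Mathlib

open MeasureTheory

noncomputable section

namespace KnotRemoval

/-- A finite knot sequence `ξ₁, …, ξ_{n+p+1}` (the degree `p` is a separate parameter),
where `n = dim` is the dimension of the spline space.  Indices start at `1`, as usual for
splines; values of `knot` outside `1, …, n+p+1` are never used. -/
structure KnotSeq where
  /-- the number `n` of B-splines -/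
  dim : ℕ
  /-- the knots `ξ_i`, `1 ≤ i ≤ n+p+1` -/
  knot : ℕ → ℝ

/-- The multiplicity of the real number `z` in `ξ₁, …, ξ_{n+p+1}`. -/
def mult (p : ℕ) (Ξ : KnotSeq) (z : ℝ) : ℕ :=
  ((Finset.Icc 1 (Ξ.dim + p + 1)).filter (fun i => Ξ.knot i = z)).card

/-- `Ξ` is a `(p+1)`-basic knot vector on `[a, b]`:
`ξ₁ ≤ … ≤ ξ_{p+1} = a < ξ_{p+2} ≤ … ≤ ξ_n < b = ξ_{n+1} ≤ … ≤ ξ_{n+p+1}`, and each interior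
breakpoint has multiplicity at most `p+1`. -/
structure IsBasic (p : ℕ) (a b : ℝ) (Ξ : KnotSeq) : Prop where
  le_dim : p + 1 ≤ Ξ.dim
  mono : ∀ i, 1 ≤ i → i ≤ Ξ.dim + p → Ξ.knot i ≤ Ξ.knot (i + 1)
  left : Ξ.knot (p + 1) = a
  right : Ξ.knot (Ξ.dim + 1) = b
  left_lt : Ξ.knot (p + 1) < Ξ.knot (p + 2)
  lt_right : Ξ.knot Ξ.dim < Ξ.knot (Ξ.dim + 1)
  mult_le : ∀ i, p + 2 ≤ i → i ≤ Ξ.dim → mult p Ξ (Ξ.knot i) ≤ p + 1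

/-- The B-spline `B_{i,q}` of degree `q` (Cox – de Boor recursion; a quotient with vanishing
denominator counts as zero).  It is right-continuous on `(-∞, b)` and left-continuous at the
right end point `b` of the interval. -/
def bspline (b : ℝ) (ξ : ℕ → ℝ) : ℕ → ℕ → ℝ → ℝ
  | 0, i, x =>
      open Classical in
      if (x < b ∧ ξ i ≤ x ∧ x < ξ (i + 1)) ∨ (b ≤ x ∧ ξ i < x ∧ x ≤ ξ (i + 1)) then 1 else 0
  | q + 1, i, x =>
      (x - ξ i) / (ξ (i + q + 1) - ξ i) * bspline b ξ q i x +
        (ξ (i + q + 2) - x) / (ξ (i + q + 2) - ξ (i + 1)) * bspline b ξ q (i + 1) x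

/-- The spline `∑_{i=1}^n c_i B_{i,p}` with control points `c₁, …, c_n`
(other values of `c` are not used). -/
def spline (p : ℕ) (b : ℝ) (Ξ : KnotSeq) (c : ℕ → ℝ) (x : ℝ) : ℝ :=
  ∑ i ∈ Finset.Icc 1 Ξ.dim, c i * bspline b Ξ.knot p i x

/-- `c₁, …, c_n` are control points of `s`: `s = ∑ c_i B_i` on `[a, b]`. -/
def IsControlPoints (p : ℕ) (a b : ℝ) (Ξ : KnotSeq) (s : ℝ → ℝ) (c : ℕ → ℝ) : Prop :=
  Set.EqOn s (spline p b Ξ c) (Set.Icc a b)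

/-- The spline space of `Ξ`: functions that on `[a, b]` are combinations of the B-splines
(functions are only considered on `[a, b]`). -/
def splineSpace (p : ℕ) (a b : ℝ) (Ξ : KnotSeq) : Set (ℝ → ℝ) :=
  {s | ∃ c : ℕ → ℝ, IsControlPoints p a b Ξ s c}

open Classical in
/-- The vector of control points of `s` (zero if `s` is not in the spline space). -/
def controlPoints (p : ℕ) (a b : ℝ) (Ξ : KnotSeq) (s : ℝ → ℝ) : ℕ → ℝ :=
  if h : ∃ c : ℕ → ℝ, IsControlPoints p a b Ξ s c then h.choose else 0

/-- The weight `ω_i = ((ξ_{i+p+1} - ξ_i) / (p+1))^{1/2}`. -/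
def weight (p : ℕ) (Ξ : KnotSeq) (i : ℕ) : ℝ :=
  Real.sqrt ((Ξ.knot (i + p + 1) - Ξ.knot i) / (p + 1))

/-- The `Ξ`-norm of a spline, `(∑_{i=1}^n c_i² (ξ_{i+p+1} - ξ_i) / (p+1))^{1/2}`, where `c` is
its vector of control points. -/
def xiNorm (p : ℕ) (a b : ℝ) (Ξ : KnotSeq) (s : ℝ → ℝ) : ℝ :=
  Real.sqrt (∑ i ∈ Finset.Icc 1 Ξ.dim,
    controlPoints p a b Ξ s i ^ 2 * ((Ξ.knot (i + p + 1) - Ξ.knot i) / (p + 1)))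

/-- The positions of removable knots: for each interior breakpoint, the index of the last knot
that is equal to it. -/
def removable (p : ℕ) (Ξ : KnotSeq) : Finset ℕ :=
  open Classical in
  (Finset.Icc (p + 2) Ξ.dim).filter (fun i => Ξ.knot i < Ξ.knot (i + 1))

/-- The knot sequence `Ξ ∖ {ξ_{i₀}}`. -/
def remove (Ξ : KnotSeq) (i₀ : ℕ) : KnotSeq where
  dim := Ξ.dim - 1
  knot := fun i => if i < i₀ then Ξ.knot i else Ξ.knot (i + 1)

/-- The error indicator `min_{g ∈ Ŝ} ‖g - s‖_Ξ`, with `Ŝ` the spline space of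
`Ξ ∖ {ξ_{i₀}}`. -/
def indicator (p : ℕ) (a b : ℝ) (Ξ : KnotSeq) (s : ℝ → ℝ) (i₀ : ℕ) : ℝ :=
  sInf ((fun g : ℝ → ℝ => xiNorm p a b Ξ (g - s)) '' splineSpace p a b (remove Ξ i₀))

/-- `ℓ`, the multiplicity of `ξ_{i₀}` minus one. -/
def ell (p : ℕ) (Ξ : KnotSeq) (i₀ : ℕ) : ℕ := mult p Ξ (Ξ.knot i₀) - 1

/-- `α_j = λ_{i₀-p-2+j}`, with `λ_i = (ξ_{i₀} - ξ_i) / (ξ_{i+p+1} - ξ_i)`; here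
`j = r + 1` with `r` starting at `0`. -/
def alpha (p : ℕ) (Ξ : KnotSeq) (i₀ r : ℕ) : ℝ :=
  (Ξ.knot i₀ - Ξ.knot (i₀ - p - 1 + r)) /
    (Ξ.knot (i₀ - p - 1 + r + p + 1) - Ξ.knot (i₀ - p - 1 + r))

/-- The local knot insertion matrix, of size `(p+2-ℓ) × (p+1-ℓ)`: `α_j` on the diagonal and
`1 - α_j` below it. -/
def Aloc (p : ℕ) (Ξ : KnotSeq) (i₀ : ℕ) :
    Matrix (Fin (p + 2 - ell p Ξ i₀)) (Fin (p + 1 - ell p Ξ i₀)) ℝ :=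
  Matrix.of fun r t =>
    if (t : ℕ) = r then alpha p Ξ i₀ r
    else if (t : ℕ) + 1 = r then 1 - alpha p Ξ i₀ r
    else 0

/-- The diagonal matrix of the weights `ω_{i₀-p-1}, …, ω_{i₀-ℓ}`. -/
def Eloc (p : ℕ) (Ξ : KnotSeq) (i₀ : ℕ) :
    Matrix (Fin (p + 2 - ell p Ξ i₀)) (Fin (p + 2 - ell p Ξ i₀)) ℝ :=
  Matrix.diagonal fun r => weight p Ξ (i₀ - p - 1 + r)

/-- The local control points `c_{i₀-p-1}, …, c_{i₀-ℓ}`. -/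
def extractLoc (p : ℕ) (Ξ : KnotSeq) (i₀ : ℕ) (c : ℕ → ℝ) : Fin (p + 2 - ell p Ξ i₀) → ℝ :=
  fun r => c (i₀ - p - 1 + r)

/-- `x` is a least squares solution of `M x = y` (Euclidean norm). -/
def IsLeastSquares {k m : ℕ} (M : Matrix (Fin k) (Fin m) ℝ) (y : Fin k → ℝ) (x : Fin m → ℝ) :
    Prop :=
  ∀ z : Fin m → ℝ,
    ‖(WithLp.toLp 2 (M.mulVec x - y) : EuclideanSpace ℝ (Fin k))‖ ≤
      ‖(WithLp.toLp 2 (M.mulVec z - y) : EuclideanSpace ℝ (Fin k))‖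

/-- The new control points: `c_i` for `i ≤ i₀-p-2`, the new local control points `x` for
`i₀-p-1 ≤ i ≤ i₀-ℓ-1`, and `c_{i+1}` for `i ≥ i₀-ℓ`. -/
def assemble (p : ℕ) (Ξ : KnotSeq) (i₀ : ℕ) (c : ℕ → ℝ) (x : Fin (p + 1 - ell p Ξ i₀) → ℝ) :
    ℕ → ℝ :=
  fun i =>
    if i + p + 1 < i₀ then c i
    else if h : i - (i₀ - p - 1) < p + 1 - ell p Ξ i₀ then x ⟨i - (i₀ - p - 1), h⟩
    else c (i + 1)

/-- The variables of the algorithm: the iteration counter `k`, the current value of the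
tolerance, the current knots and the current control points. -/
structure State where
  iter : ℕ
  tol : ℝ
  knots : KnotSeq
  coeff : ℕ → ℝ

/-- The indicators `ε_j^{(k)}` of the current spline. -/
def State.eps (p : ℕ) (a b : ℝ) (σ : State) (i : ℕ) : ℝ :=
  indicator p a b σ.knots (spline p b σ.knots σ.coeff) i

/-- The knot with index `i` may be chosen, i.e. it minimizes the indicator. -/
def State.IsArgmin (p : ℕ) (a b : ℝ) (σ : State) (i : ℕ) : Prop :=
  i ∈ removable p σ.knots ∧ ∀ j ∈ removable p σ.knots, σ.eps p a b i ≤ σ.eps p a b j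

/-- The condition of the while loop: the minimal indicator is below the current tolerance, and
`k < k_max`. -/
def State.Continues (p : ℕ) (a b : ℝ) (kmax : ℕ) (σ : State) : Prop :=
  (∃ i, σ.IsArgmin p a b i ∧ σ.eps p a b i < σ.tol) ∧ σ.iter < kmax

/-- One pass through the body of the while loop.  The choice among several minimizers of the
indicator is left open. -/
def Step (p : ℕ) (a b : ℝ) (kmax : ℕ) (σ τ : State) : Prop :=
  σ.Continues p a b kmax ∧
  ∃ i, σ.IsArgmin p a b i ∧
    ∃ x : Fin (p + 1 - ell p σ.knots i) → ℝ,
      IsLeastSquares (Eloc p σ.knots i * Aloc p σ.knots i)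
        ((Eloc p σ.knots i).mulVec (extractLoc p σ.knots i σ.coeff)) x ∧
      τ.iter = σ.iter + 1 ∧
      τ.tol = σ.tol - σ.eps p a b i ∧
      τ.knots = remove σ.knots i ∧
      τ.coeff = assemble p σ.knots i σ.coeff x

/-- The state before the while loop. -/
def start (tol : ℝ) (Ξ : KnotSeq) (c : ℕ → ℝ) : State where
  iter := 0
  tol := tol
  knots := Ξ
  coeff := c

/-- `k_max = #Ξ - 2(p+1)`, the number of interior knots. -/
def kMax (p : ℕ) (Ξ : KnotSeq) : ℕ := (Ξ.dim + p + 1) - 2 * (p + 1)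

/-- `σ 0, …, σ K` are the successive states of an execution of `K` passes through the loop. -/
def IsExecution (p : ℕ) (a b tol : ℝ) (Ξ : KnotSeq) (c : ℕ → ℝ) (K : ℕ) (σ : ℕ → State) :
    Prop :=
  σ 0 = start tol Ξ c ∧ ∀ k < K, Step p a b (kMax p Ξ) (σ k) (σ (k + 1))

/-- The algorithm stops after `K` passes through the loop and returns the knots `Ξ'` and the
control points `c'`. -/
def Returns (p : ℕ) (a b tol : ℝ) (Ξ : KnotSeq) (c : ℕ → ℝ) (K : ℕ) (Ξ' : KnotSeq)
    (c' : ℕ → ℝ) : Prop :=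
  ∃ σ : ℕ → State, IsExecution p a b tol Ξ c K σ ∧
    ¬ (σ K).Continues p a b (kMax p Ξ) ∧ Ξ' = (σ K).knots ∧ c' = (σ K).coeff

end KnotRemoval

end

/-! The proof rests on an invariant: after k passes, ‖s - s_k‖_Ξ ≤ TOL - τ_k and τ_k > 0. Since s -
s_{k+1} = (s - s_k) - (s_{k+1} - s_k), the triangle inequality preserves it (`Invariant.step`),
given two facts about removing one knot.

The first is that s_{k+1} attains the indicator: its distance from s_k in the norm of Ξ^(k) is ε^(k)
(`IsBasic.indicator_eq`). Reinserting the knot turns coefficients c_i into λ_i c_i + (1 - λ_i)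
c_{i-1}, where λ_i = 1 to the left and λ_i = 0 to the right of a window of p+2-ℓ indices. Outside
the window the old coefficients are therefore reproduced without error, and the global minimization
reduces to the local weighted least squares problem (`IsBasic.coeffSq_assemble_le`).

The second is that the coefficient norm does not grow under refinement, so ‖·‖_Ξ ≤ ‖·‖_{Ξ^(k)} on
the coarser space. The new coefficients are convex combinations of the old ones, and the weights of
the coarse B-splines split with the same λ_i, so convexity of the square suffices
(`IsBasic.coeffSq_insertCoeff_le`).

The L² bound is Jensen's inequality for the partition of unity together with ∫ B_i = (ξ_{i+p+1} -
ξ_i)/(p+1) (`integral_bspline`). Linear independence of the B-splines (`IsBasic.coeff_eq_zero`)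
makes the coefficient norm independent of the choice of control points. Termination follows from the
bound on the counter. -/

namespace KnotRemoval

/-- The point `x` lies in the knot interval `[ξ_i, ξ_{i+1})`, or in `(ξ_i, ξ_{i+1}]` if it is not
to the left of `b`. -/
def InCell (b : ℝ) (ξ : ℕ → ℝ) (i : ℕ) (x : ℝ) : Prop :=
  (x < b ∧ ξ i ≤ x ∧ x < ξ (i + 1)) ∨ (b ≤ x ∧ ξ i < x ∧ x ≤ ξ (i + 1))

/-! ### B-splines on one knot interval: locality, Marsden's identity, local independence. -/

section Bspline

variable {b : ℝ} {ξ η : ℕ → ℝ} {i j μ q : ℕ} {x : ℝ}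

lemma bspline_zero_of_inCell (h : InCell b ξ i x) : bspline b ξ 0 i x = 1 := by
  unfold InCell at h
  simp [bspline, h]

lemma bspline_zero_of_not_inCell (h : ¬ InCell b ξ i x) : bspline b ξ 0 i x = 0 := by
  unfold InCell at h
  simp [bspline, h]

lemma bspline_succ (b : ℝ) (ξ : ℕ → ℝ) (q i : ℕ) (x : ℝ) :
    bspline b ξ (q + 1) i x =
      (x - ξ i) / (ξ (i + q + 1) - ξ i) * bspline b ξ q i x +
        (ξ (i + q + 2) - x) / (ξ (i + q + 2) - ξ (i + 1)) * bspline b ξ q (i + 1) x := rfl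

lemma bspline_congr (h : ∀ r ≤ q + 1, ξ (i + r) = η (j + r)) (x : ℝ) :
    bspline b ξ q i x = bspline b η q j x := by
  induction q generalizing i j with
  | zero =>
    have h0 := h 0 (by omega)
    have h1 := h 1 (by omega)
    simp only [add_zero] at h0
    simp only [bspline, h0, h1]
  | succ q ih =>
    have h0 := h 0 (by omega)
    have h1 := h 1 (by omega)
    have h2 := h (q + 1) (by omega)
    have h3 := h (q + 2) (by omega)
    simp only [add_zero] at h0
    rw [bspline_succ, bspline_succ, ih (i := i) (j := j) fun r hr => h r (by omega),
      ih (i := i + 1) (j := j + 1) fun r hr => by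
        rw [add_assoc, add_assoc, add_comm 1 r]; exact h (r + 1) (by omega)]
    simp only [add_assoc, h0, h1, h2, h3]

lemma InCell.lt (h : InCell b ξ i x) : ξ i < ξ (i + 1) := by
  rcases h with h | h <;> linarith [h.2.1, h.2.2]

lemma InCell.le_left (h : InCell b ξ i x) : ξ i ≤ x := by
  rcases h with h | h <;> linarith [h.2.1]

lemma InCell.le_right (h : InCell b ξ i x) : x ≤ ξ (i + 1) := by
  rcases h with h | h <;> linarith [h.2.2]

lemma InCell.not_lt (hξ : Monotone ξ) (h : InCell b ξ i x) (h' : InCell b ξ j x) : ¬ i < j := by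
  intro hij
  have := hξ (show i + 1 ≤ j from hij)
  rcases h with h | h <;> rcases h' with h' | h' <;>
    linarith [h.1, h.2.1, h.2.2, h'.1, h'.2.1, h'.2.2]

lemma InCell.unique (hξ : Monotone ξ) (h : InCell b ξ i x) (h' : InCell b ξ j x) : i = j :=
  le_antisymm (le_of_not_gt (h'.not_lt hξ h)) (le_of_not_gt (h.not_lt hξ h'))

lemma bspline_eq_zero_of_cell_lt (hξ : Monotone ξ) (h : InCell b ξ μ x) (hi : μ < i) :
    bspline b ξ q i x = 0 := by
  induction q generalizing i with
  | zero => exact bspline_zero_of_not_inCell fun h' => (h.unique hξ h' ▸ hi).false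
  | succ q ih => rw [bspline_succ, ih hi, ih (by omega)]; simp

lemma bspline_eq_zero_of_lt_cell (hξ : Monotone ξ) (h : InCell b ξ μ x) (hi : i + q < μ) :
    bspline b ξ q i x = 0 := by
  induction q generalizing i with
  | zero =>
    exact bspline_zero_of_not_inCell fun h' => by have := h.unique hξ h'; omega
  | succ q ih => rw [bspline_succ, ih (by omega), ih (by omega)]; simp

lemma bspline_eq_zero_of_lt (hξ : Monotone ξ) (h : x < ξ i) : bspline b ξ q i x = 0 := by
  induction q generalizing i with
  | zero => exact bspline_zero_of_not_inCell fun h' => by linarith [h'.le_left]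
  | succ q ih => rw [bspline_succ, ih h, ih (h.trans_le (hξ (by omega)))]; simp

lemma bspline_eq_zero_of_gt (hξ : Monotone ξ) (h : ξ (i + q + 1) < x) :
    bspline b ξ q i x = 0 := by
  induction q generalizing i with
  | zero => exact bspline_zero_of_not_inCell fun h' => by linarith [h'.le_right]
  | succ q ih =>
    rw [bspline_succ, ih ((hξ (by omega)).trans_lt h), ih (by convert h using 2; omega)]; simp

/-- The degenerate case that makes the convention 0/0 = 0 harmless: whenever a denominator of the
recursion vanishes, so does its numerator. -/
lemma bspline_eq_zero_of_eq (hξ : Monotone ξ) (h : ξ (i + q + 1) = ξ i) :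
    bspline b ξ q i x = 0 := by
  induction q generalizing i with
  | zero => exact bspline_zero_of_not_inCell fun h' => by linarith [h'.lt]
  | succ q ih =>
    have h1 : ξ i ≤ ξ (i + 1) := hξ (by omega)
    have h2 : ξ (i + 1) ≤ ξ (i + q + 1) := hξ (by omega)
    have h3 : ξ (i + q + 1) ≤ ξ (i + q + 2) := hξ (by omega)
    have h4 : ξ (i + (q + 1) + 1) = ξ (i + q + 2) := rfl
    have h5 : ξ (i + 1 + q + 1) = ξ (i + q + 2) := by congr 1; omega
    rw [bspline_succ, ih (by linarith), ih (by linarith)]; simp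

lemma bspline_nonneg (hξ : Monotone ξ) (b : ℝ) (q i : ℕ) (x : ℝ) : 0 ≤ bspline b ξ q i x := by
  induction q generalizing i with
  | zero =>
    by_cases h : InCell b ξ i x
    · simp [bspline_zero_of_inCell h]
    · simp [bspline_zero_of_not_inCell h]
  | succ q ih =>
    rw [bspline_succ]
    apply add_nonneg
    · rcases lt_or_ge x (ξ i) with h | h
      · simp [bspline_eq_zero_of_lt hξ h]
      · exact mul_nonneg (div_nonneg (by linarith)
          (by linarith [hξ (show i ≤ i + q + 1 by omega)])) (ih i)
    · rcases lt_or_ge (ξ (i + 1 + q + 1)) x with h | h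
      · simp [bspline_eq_zero_of_gt hξ h]
      · rw [show i + 1 + q + 1 = i + q + 2 by omega] at h
        exact mul_nonneg (div_nonneg (by linarith)
          (by linarith [hξ (show i + 1 ≤ i + q + 2 by omega)])) (ih (i + 1))

/-- One step of the de Boor algorithm on a knot interval. -/
lemma sum_bspline_succ (hξ : Monotone ξ) (h : InCell b ξ (i + q + 1) x) (c : ℕ → ℝ) :
    ∑ r ∈ Finset.range (q + 2), c (i + r) * bspline b ξ (q + 1) (i + r) x =
      ∑ r ∈ Finset.range (q + 1),
        (c (i + 1 + r) * (x - ξ (i + 1 + r)) + c (i + r) * (ξ (i + 1 + r + q + 1) - x)) /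
          (ξ (i + 1 + r + q + 1) - ξ (i + 1 + r)) * bspline b ξ q (i + 1 + r) x := by
  simp only [bspline_succ, mul_add, Finset.sum_add_distrib]
  -- The two extreme splines of degree q, with indices i and i+q+2, vanish on the cell i+q+1;
  -- dropping them aligns the two shifted sums.
  rw [Finset.sum_range_succ', Finset.sum_range_succ (fun r => c (i + r) * (_ * _)),
    bspline_eq_zero_of_lt_cell (i := i + 0) hξ h (by omega),
    bspline_eq_zero_of_cell_lt (i := i + (q + 1) + 1) hξ h (by omega)]
  simp only [mul_zero, add_zero, ← Finset.sum_add_distrib]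
  refine Finset.sum_congr rfl fun r _ => ?_
  rw [show i + (r + 1) = i + 1 + r by omega, show i + r + 1 = i + 1 + r by omega,
    show i + r + q + 2 = i + 1 + r + q + 1 by omega]
  ring

lemma InCell.sub_pos (hξ : Monotone ξ) (h : InCell b ξ μ x) (hi : i ≤ μ) (hj : μ + 1 ≤ j) :
    0 < ξ j - ξ i := by
  linarith [hξ hi, hξ hj, h.lt]

lemma sum_bspline_cell (hξ : Monotone ξ) (h : InCell b ξ (i + q) x) :
    ∑ r ∈ Finset.range (q + 1), bspline b ξ q (i + r) x = 1 := by
  induction q generalizing i with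
  | zero => simpa using bspline_zero_of_inCell h
  | succ q ih =>
    have h1 := sum_bspline_succ hξ h (fun _ => 1)
    simp only [one_mul] at h1
    rw [h1, ← ih (i := i + 1) (by convert h using 1; omega)]
    refine Finset.sum_congr rfl fun r hr => ?_
    rw [Finset.mem_range] at hr
    have := h.sub_pos (i := i + 1 + r) (j := i + 1 + r + q + 1) hξ (by omega) (by omega)
    rw [sub_add_sub_cancel', div_self this.ne', one_mul]

/-- Marsden's identity on a knot interval. -/
lemma marsden (hξ : Monotone ξ) (h : InCell b ξ (i + q) x) (y : ℝ) :
    ∑ r ∈ Finset.range (q + 1),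
      (∏ k ∈ Finset.range q, (y - ξ (i + r + 1 + k))) * bspline b ξ q (i + r) x = (y - x) ^ q := by
  induction q generalizing i with
  | zero => simpa using bspline_zero_of_inCell h
  | succ q ih =>
    -- One de Boor step on the dual products extracts a factor y - x. With u and v the end knots of
    -- the support, (y - v)(x - u) + (y - u)(v - x) = (y - x)(v - u).
    rw [sum_bspline_succ hξ h (fun j => ∏ k ∈ Finset.range (q + 1), (y - ξ (j + 1 + k))),
      pow_succ', ← ih (i := i + 1) (by convert h using 1; omega), Finset.mul_sum]
    refine Finset.sum_congr rfl fun r hr => ?_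
    rw [Finset.mem_range] at hr
    have := (h.sub_pos (i := i + 1 + r) (j := i + 1 + r + q + 1) hξ (by omega) (by omega)).ne'
    rw [Finset.prod_range_succ, Finset.prod_range_succ', ← mul_assoc]
    congr 1
    rw [div_eq_iff this, show i + 1 + r + 1 + q = i + 1 + r + q + 1 by omega,
      show i + r + 1 + 0 = i + 1 + r by omega]
    have hprod : ∏ k ∈ Finset.range q, (y - ξ (i + 1 + r + (k + 1))) =
        ∏ k ∈ Finset.range q, (y - ξ (i + 1 + r + 1 + k)) :=
      Finset.prod_congr rfl fun k _ => by
        rw [show i + 1 + r + (k + 1) = i + 1 + r + 1 + k by omega]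
    rw [hprod]
    ring

/-- The binomial theorem factors the matrix as Vandermonde, times binomial coefficients on a
diagonal, times a transposed Vandermonde with its rows reversed. -/
lemma det_sub_pow_ne_zero {p : ℕ} {x y : Fin (p + 1) → ℝ} (hx : Function.Injective x)
    (hy : Function.Injective y) :
    (Matrix.of fun j k : Fin (p + 1) => (y j - x k) ^ p).det ≠ 0 := by
  have h1 : (Matrix.of fun j k : Fin (p + 1) => (y j - x k) ^ p) =
      Matrix.vandermonde y * (Matrix.diagonal (fun m : Fin (p + 1) => (p.choose m : ℝ)) *
        (Matrix.vandermonde (fun k => - x k)).transpose.submatrix Fin.revPerm id) := by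
    ext j k
    rw [Matrix.mul_apply, Matrix.of_apply, sub_eq_add_neg, add_pow, Finset.sum_range]
    refine Finset.sum_congr rfl fun m _ => ?_
    rw [Matrix.diagonal_mul]
    simp only [Matrix.vandermonde_apply, Matrix.submatrix_apply, Matrix.transpose_apply, id,
      Fin.revPerm_apply, Fin.val_rev]
    rw [show p + 1 - ((m : ℕ) + 1) = p - m by omega]
    ring
  rw [h1, Matrix.det_mul, Matrix.det_mul, Matrix.det_diagonal, Matrix.det_permute,
    Matrix.det_transpose]
  refine mul_ne_zero (Matrix.det_vandermonde_ne_zero_iff.2 hy)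
    (mul_ne_zero (Finset.prod_ne_zero_iff.2 fun m _ => ?_) (mul_ne_zero ?_
      (Matrix.det_vandermonde_ne_zero_iff.2 fun k l hkl => hx (neg_injective hkl))))
  · exact_mod_cast (Nat.choose_pos (by omega)).ne'
  · rcases Int.units_eq_one_or (Equiv.Perm.sign (Fin.revPerm (n := p + 1))) with h | h <;> simp [h]

/-- Local linear independence of the B-splines. -/
lemma coeff_eq_zero_of_cell {c : ℕ → ℝ} (hξ : Monotone ξ) (hlt : ξ (i + q) < ξ (i + q + 1))
    (hb : ξ (i + q + 1) ≤ b)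
    (h : ∀ x, InCell b ξ (i + q) x →
      ∑ r ∈ Finset.range (q + 1), c (i + r) * bspline b ξ q (i + r) x = 0) :
    ∀ r ≤ q, c (i + r) = 0 := by
  let e := (Set.Ioo_infinite hlt).natEmbedding
  let X : Fin (q + 1) → ℝ := fun k => e k
  have hX : ∀ k, InCell b ξ (i + q) (X k) := fun k =>
    Or.inl ⟨(e k).2.2.trans_le hb, (e k).2.1.le, (e k).2.2⟩
  have hXinj : Function.Injective X := fun k l hkl =>
    Fin.ext (e.injective (Subtype.ext hkl))
  let Bm : Matrix (Fin (q + 1)) (Fin (q + 1)) ℝ :=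
    Matrix.of fun r k => bspline b ξ q (i + r) (X k)
  -- Marsden's identity at q+1 distinct points of the cell exhibits an invertible matrix as a
  -- product with the collocation matrix `Bm` as right factor, so `Bm` is invertible too.
  have h1 : (Matrix.of fun j k : Fin (q + 1) => (X j - X k) ^ q) =
      (Matrix.of fun j r : Fin (q + 1) =>
        ∏ k ∈ Finset.range q, (X j - ξ (i + r + 1 + k))) * Bm := by
    ext j k
    rw [Matrix.mul_apply, Matrix.of_apply, ← marsden hξ (hX k) (X j), Finset.sum_range]
    rfl
  have hdet : Bm.det ≠ 0 := by
    have := det_sub_pow_ne_zero hXinj hXinj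
    rw [h1, Matrix.det_mul] at this
    exact right_ne_zero_of_mul this
  have h2 : Matrix.vecMul (fun r : Fin (q + 1) => c (i + r)) Bm = 0 := by
    ext k
    have := h _ (hX k)
    rw [Finset.sum_range] at this
    exact this
  have h3 := Matrix.eq_zero_of_vecMul_eq_zero hdet h2
  intro r hr
  exact congrFun h3 ⟨r, by omega⟩

end Bspline

end KnotRemoval

namespace KnotRemoval

/-! ### Knot insertion for B-splines on a monotone sequence. -/

section Insertion

variable {b : ℝ} {ξ : ℕ → ℝ} {i i₀ p q : ℕ} {x : ℝ}

/-- The sequence `ξ` without its element with index `i₀`. -/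
def dropKnot (ξ : ℕ → ℝ) (i₀ : ℕ) : ℕ → ℝ := fun i => if i < i₀ then ξ i else ξ (i + 1)

lemma dropKnot_of_lt (h : i < i₀) : dropKnot ξ i₀ i = ξ i := if_pos h

lemma dropKnot_of_le (h : i₀ ≤ i) : dropKnot ξ i₀ i = ξ (i + 1) := if_neg (not_lt.2 h)

lemma sub_mul_bspline_div (hξ : Monotone ξ) (q i : ℕ) (x : ℝ) :
    (ξ (i + q + 1) - ξ i) * (bspline b ξ q i x / (ξ (i + q + 1) - ξ i)) = bspline b ξ q i x := by
  by_cases h : ξ (i + q + 1) - ξ i = 0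
  · rw [h, bspline_eq_zero_of_eq hξ (by linarith)]; simp
  · field_simp

lemma bspline_succ' (b : ℝ) (ξ : ℕ → ℝ) (q i : ℕ) (x : ℝ) :
    bspline b ξ (q + 1) i x =
      (x - ξ i) * (bspline b ξ q i x / (ξ (i + q + 1) - ξ i)) +
        (ξ (i + 1 + q + 1) - x) *
          (bspline b ξ q (i + 1) x / (ξ (i + 1 + q + 1) - ξ (i + 1))) := by
  rw [bspline_succ, show i + 1 + q + 1 = i + q + 2 by omega]
  ring

/-- The recursion in the point x and the insertion of the knot t have the same algebraic form and
commute. Here u, v, w stand for three consecutive B-splines divided by the lengths of their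
supports; the hypotheses cover vanishing denominators. -/
lemma insertion_identity {x t a a₁ e e₁ u v w : ℝ} (h : e - a = 0 → v = 0)
    (h₁ : e₁ - a₁ = 0 → v = 0) :
    (x - a) * (((t - a) * u + (e - t) * v) / (e - a)) +
        (e₁ - x) * (((t - a₁) * v + (e₁ - t) * w) / (e₁ - a₁)) =
      (t - a) * (((x - a) * u + (e - x) * v) / (e - a)) +
        (e₁ - t) * (((x - a₁) * v + (e₁ - x) * w) / (e₁ - a₁)) := by
  by_cases hD : e - a = 0
  · simp only [hD, h hD, div_zero]; ring
  by_cases hD₁ : e₁ - a₁ = 0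
  · simp only [hD₁, h₁ hD₁, div_zero]; ring
  field_simp
  ring

lemma bspline_dropKnot_of_lt (h : i + q + 1 < i₀) :
    bspline b (dropKnot ξ i₀) q i x = bspline b ξ q i x :=
  bspline_congr (fun r hr => dropKnot_of_lt (by omega)) x

lemma bspline_dropKnot_of_le (h : i₀ ≤ i) :
    bspline b (dropKnot ξ i₀) q i x = bspline b ξ q (i + 1) x :=
  bspline_congr (fun r hr => by
    rw [dropKnot_of_le (by omega)]; congr 1; omega) x

/-- Knot insertion, for the B-splines whose support contains the inserted knot. -/
lemma bspline_dropKnot_mid (hξ : Monotone ξ) (hi : i < i₀) (hi' : i₀ ≤ i + q + 1) :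
    bspline b (dropKnot ξ i₀) q i x =
      (ξ i₀ - ξ i) * (bspline b ξ q i x / (ξ (i + q + 1) - ξ i)) +
        (ξ (i + 1 + q + 1) - ξ i₀) *
          (bspline b ξ q (i + 1) x / (ξ (i + 1 + q + 1) - ξ (i + 1))) := by
  induction q generalizing i with
  | zero =>
    obtain rfl : i₀ = i + 1 := by omega
    have e1 := sub_mul_bspline_div (b := b) hξ 0 i x
    have e2 := sub_mul_bspline_div (b := b) hξ 0 (i + 1) x
    simp only [add_zero] at e1 e2 ⊢
    rw [e1, e2]
    have h1 := hξ (show i ≤ i + 1 by omega)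
    have h2 := hξ (show i + 1 ≤ i + 1 + 1 by omega)
    have key : InCell b (dropKnot ξ (i + 1)) i x ↔ InCell b ξ i x ∨ InCell b ξ (i + 1) x := by
      unfold InCell
      rw [dropKnot_of_lt (by omega), dropKnot_of_le le_rfl]
      constructor
      · rintro (h | h)
        · rcases lt_or_ge x (ξ (i + 1)) with h' | h'
          · exact Or.inl (Or.inl ⟨h.1, h.2.1, h'⟩)
          · exact Or.inr (Or.inl ⟨h.1, h', h.2.2⟩)
        · rcases lt_or_ge (ξ (i + 1)) x with h' | h'
          · exact Or.inr (Or.inr ⟨h.1, h', h.2.2⟩)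
          · exact Or.inl (Or.inr ⟨h.1, h.2.1, h'⟩)
      · rintro ((h | h) | (h | h))
        · exact Or.inl ⟨h.1, h.2.1, h.2.2.trans_le h2⟩
        · exact Or.inr ⟨h.1, h.2.1, h.2.2.trans h2⟩
        · exact Or.inl ⟨h.1, h1.trans h.2.1, h.2.2⟩
        · exact Or.inr ⟨h.1, h1.trans_lt h.2.1, h.2.2⟩
    by_cases hc : InCell b ξ i x
    · have hc' : ¬ InCell b ξ (i + 1) x := fun h => by have := hc.unique hξ h; omega
      rw [bspline_zero_of_inCell (key.2 (Or.inl hc)), bspline_zero_of_inCell hc,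
        bspline_zero_of_not_inCell hc', add_zero]
    · by_cases hc' : InCell b ξ (i + 1) x
      · rw [bspline_zero_of_inCell (key.2 (Or.inr hc')), bspline_zero_of_inCell hc',
          bspline_zero_of_not_inCell hc, zero_add]
      · rw [bspline_zero_of_not_inCell (by tauto), bspline_zero_of_not_inCell hc,
          bspline_zero_of_not_inCell hc', add_zero]
  | succ q ih =>
    have hv : ∀ j k, j ≤ i + 1 → i + 1 + q + 1 ≤ k → ξ k - ξ j = 0 →
        bspline b ξ q (i + 1) x / (ξ (i + 1 + q + 1) - ξ (i + 1)) = 0 := by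
      intro j k hj hk h
      have h1 := hξ hj
      have h2 := hξ hk
      have h3 := hξ (show i + 1 ≤ i + 1 + q + 1 by omega)
      rw [bspline_eq_zero_of_eq hξ (by linarith), zero_div]
    have hL : (x - dropKnot ξ i₀ i) * (bspline b (dropKnot ξ i₀) q i x /
          (dropKnot ξ i₀ (i + q + 1) - dropKnot ξ i₀ i)) =
        (x - ξ i) * (((ξ i₀ - ξ i) * (bspline b ξ q i x / (ξ (i + q + 1) - ξ i)) +
        (ξ (i + 1 + q + 1) - ξ i₀) *
          (bspline b ξ q (i + 1) x / (ξ (i + 1 + q + 1) - ξ (i + 1)))) /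
            (ξ (i + 1 + q + 1) - ξ i)) := by
      rw [dropKnot_of_lt hi]
      -- If the inserted knot lies just beyond the support of the degree q spline with index i, that
      -- spline is unchanged and the second term has factor 0. The case i₀ = i + 1 in `hR` is the
      -- mirror image.
      rcases hi'.lt_or_eq with h | rfl
      · rw [ih hi (by omega), dropKnot_of_le (by omega),
          show i + q + 1 + 1 = i + 1 + q + 1 by omega]
      · rw [bspline_dropKnot_of_lt (by omega), dropKnot_of_lt (by omega),
          show i + (q + 1) + 1 = i + 1 + q + 1 by omega, sub_self, zero_mul, add_zero]
        by_cases h : ξ (i + 1 + q + 1) - ξ i = 0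
        · have h1 := hξ (show i ≤ i + q + 1 by omega)
          have h2 := hξ (show i + q + 1 ≤ i + 1 + q + 1 by omega)
          rw [bspline_eq_zero_of_eq hξ (by linarith)]
          simp
        · rw [mul_div_cancel_left₀ _ h]
    have hR : (dropKnot ξ i₀ (i + 1 + q + 1) - x) * (bspline b (dropKnot ξ i₀) q (i + 1) x /
          (dropKnot ξ i₀ (i + 1 + q + 1) - dropKnot ξ i₀ (i + 1))) =
        (ξ (i + 1 + 1 + q + 1) - x) * (((ξ i₀ - ξ (i + 1)) *
          (bspline b ξ q (i + 1) x / (ξ (i + 1 + q + 1) - ξ (i + 1))) +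
        (ξ (i + 1 + 1 + q + 1) - ξ i₀) *
          (bspline b ξ q (i + 1 + 1) x / (ξ (i + 1 + 1 + q + 1) - ξ (i + 1 + 1)))) /
            (ξ (i + 1 + 1 + q + 1) - ξ (i + 1))) := by
      rw [dropKnot_of_le (i := i + 1 + q + 1) (by omega),
        show i + 1 + q + 1 + 1 = i + 1 + 1 + q + 1 by omega]
      rcases (show i + 1 ≤ i₀ from hi).lt_or_eq with h | rfl
      · rw [ih h (by omega), dropKnot_of_lt h]
      · rw [bspline_dropKnot_of_le le_rfl, dropKnot_of_le le_rfl, sub_self, zero_mul, zero_add]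
        by_cases h : ξ (i + 1 + 1 + q + 1) - ξ (i + 1) = 0
        · have h1 := hξ (show i + 1 ≤ i + 1 + 1 by omega)
          have h2 := hξ (show i + 1 + 1 ≤ i + 1 + 1 + q + 1 by omega)
          rw [bspline_eq_zero_of_eq hξ (by linarith)]
          simp
        · rw [mul_div_cancel_left₀ _ h]
    rw [bspline_succ', hL, hR, insertion_identity (hv _ _ (by omega) le_rfl)
      (hv _ _ le_rfl (by omega)), bspline_succ', bspline_succ' b ξ q (i + 1)]
    rw [show i + (q + 1) + 1 = i + 1 + q + 1 by omega,
      show i + 1 + (q + 1) + 1 = i + 1 + 1 + q + 1 by omega]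

/-- The coefficients `λ_i` of the insertion of the knot with index `i₀`. -/
noncomputable def insCoef (p : ℕ) (ξ : ℕ → ℝ) (i₀ i : ℕ) : ℝ :=
  if i + p + 1 ≤ i₀ then 1 else if i₀ ≤ i then 0 else (ξ i₀ - ξ i) / (ξ (i + p + 1) - ξ i)

lemma insCoef_of_le (h : i + p + 1 ≤ i₀) : insCoef p ξ i₀ i = 1 := if_pos h

lemma insCoef_of_ge (h : i₀ ≤ i) : insCoef p ξ i₀ i = 0 := by
  rw [insCoef, if_neg (by omega), if_pos h]

lemma insCoef_of_mid (h : i₀ < i + p + 1) (h' : i < i₀) :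
    insCoef p ξ i₀ i = (ξ i₀ - ξ i) / (ξ (i + p + 1) - ξ i) := by
  rw [insCoef, if_neg (by omega), if_neg (by omega)]

/-- The values 1 and 0 of `insCoef` at the two ends let one formula cover splines left of, across
and right of the inserted knot. -/
lemma bspline_dropKnot (hξ : Monotone ξ) :
    bspline b (dropKnot ξ i₀) p i x =
      insCoef p ξ i₀ i * bspline b ξ p i x +
        (1 - insCoef p ξ i₀ (i + 1)) * bspline b ξ p (i + 1) x := by
  rcases lt_or_ge (i + p + 1) i₀ with h | h
  · rw [bspline_dropKnot_of_lt h, insCoef_of_le h.le, insCoef_of_le (by omega)]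
    ring
  rcases le_or_gt i₀ i with h' | h'
  · rw [bspline_dropKnot_of_le h', insCoef_of_ge h', insCoef_of_ge (by omega)]
    ring
  rw [bspline_dropKnot_mid hξ h' h]
  congr 1
  · rcases h.lt_or_eq with h1 | rfl
    · rw [insCoef_of_mid h1 h']; ring
    · rw [insCoef_of_le le_rfl, sub_mul_bspline_div hξ, one_mul]
  · rcases (show i + 1 ≤ i₀ from h').lt_or_eq with h1 | rfl
    · rw [insCoef_of_mid (by omega) h1]
      nth_rw 2 [← sub_mul_bspline_div hξ]
      by_cases hD : ξ (i + 1 + p + 1) - ξ (i + 1) = 0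
      · simp [hD]
      · field_simp
        ring
    · rw [insCoef_of_ge le_rfl, sub_mul_bspline_div hξ, sub_zero, one_mul]

end Insertion

/-! ### Moments and integrals of B-splines. -/

section Moments

variable {b : ℝ} {ξ : ℕ → ℝ}

/-- The complete homogeneous symmetric polynomial of degree `m` in `ξ_i, …, ξ_{i+r}`. -/
def hsym (ξ : ℕ → ℝ) : ℕ → ℕ → ℕ → ℝ
  | 0, _, _ => 1
  | m + 1, 0, i => ξ i * hsym ξ m 0 i
  | m + 1, r + 1, i => ξ i * hsym ξ m (r + 1) i + hsym ξ (m + 1) r (i + 1)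

lemma hsym_succ_succ (ξ : ℕ → ℝ) (m r i : ℕ) :
    hsym ξ (m + 1) (r + 1) i = ξ i * hsym ξ m (r + 1) i + hsym ξ (m + 1) r (i + 1) := by
  rw [hsym]

/-- The definition splits off the first variable; by symmetry the last can be split off as well. The
moment recursion needs both. -/
lemma hsym_succ_succ' (ξ : ℕ → ℝ) (m r i : ℕ) :
    hsym ξ (m + 1) (r + 1) i =
      ξ (i + r + 1) * hsym ξ m (r + 1) i + hsym ξ (m + 1) r i := by
  induction m generalizing r i with
  | zero =>
    induction r generalizing i with
    | zero => simp only [hsym]; simp only [add_zero]; ring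
    | succ r ih =>
      rw [hsym_succ_succ, ih, hsym_succ_succ ξ 0 r i, show i + 1 + r + 1 = i + (r + 1) + 1 by omega]
      simp only [hsym]
      ring
  | succ m ihm =>
    induction r generalizing i with
    | zero =>
      rw [hsym_succ_succ, ihm]
      simp only [hsym]
      simp only [add_zero]
      have := hsym_succ_succ ξ m 0 i
      rw [ihm] at this
      simp only [hsym, add_zero] at this
      linear_combination (-ξ (i + 1)) * this
    | succ r ih =>
      rw [hsym_succ_succ, ih, hsym_succ_succ ξ (m + 1) r i, ihm,
        show i + 1 + r + 1 = i + (r + 1) + 1 by omega]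
      have := hsym_succ_succ ξ m (r + 1) i
      rw [ihm] at this
      linear_combination (-ξ (i + (r + 1) + 1)) * this

/-- With r+1 equal variables the sum has binom(m+r, r) monomials, all equal to t^m. -/
lemma hsym_of_const {t : ℝ} {r i : ℕ} (h : ∀ k ≤ r, ξ (i + k) = t) (m : ℕ) :
    hsym ξ m r i * (m.factorial * r.factorial) = t ^ m * (m + r).factorial := by
  induction m generalizing r i with
  | zero => simp [hsym]
  | succ m ihm =>
    induction r generalizing i with
    | zero =>
      have h1 := ihm h
      have h0 := h 0 le_rfl
      simp only [add_zero] at h0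
      simp only [hsym, h0, Nat.factorial_succ, Nat.factorial_zero, add_zero] at h1 ⊢
      push_cast at h1 ⊢
      linear_combination t * (m + 1) * h1
    | succ r ihr =>
      have h1 := ihm h
      have h2 := ihr (i := i + 1) fun k hk => by
        rw [show i + 1 + k = i + (k + 1) by omega]; exact h _ (by omega)
      have h0 := h 0 (Nat.zero_le _)
      simp only [add_zero] at h0
      rw [hsym_succ_succ, h0]
      rw [show m + (r + 1) = m + 1 + r by omega] at h1
      rw [show m + 1 + (r + 1) = (m + 1 + r) + 1 by omega]
      rw [Nat.factorial_succ (m + 1 + r)]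
      rw [Nat.factorial_succ] at h1 ⊢
      rw [Nat.factorial_succ] at h2 ⊢
      push_cast at h1 h2 ⊢
      linear_combination t * (m + 1) * h1 + (r + 1) * h2

/-- The one-sided conventions at the knots and at b concern only end points, which form a null set.
-/
lemma bspline_zero_ae (b : ℝ) (ξ : ℕ → ℝ) (i : ℕ) :
    bspline b ξ 0 i =ᵐ[volume] (Set.Ioc (ξ i) (ξ (i + 1))).indicator 1 := by
  have : ∀ᵐ x : ℝ, x ∉ ({ξ i, ξ (i + 1)} : Set ℝ) :=
    measure_eq_zero_iff_ae_notMem.1 ((Set.toFinite _).measure_zero _)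
  filter_upwards [this] with x hx
  simp only [Set.mem_insert_iff, Set.mem_singleton_iff, not_or] at hx
  by_cases h : InCell b ξ i x
  · rw [bspline_zero_of_inCell h, Set.indicator_of_mem]
    · rfl
    · exact ⟨lt_of_le_of_ne h.le_left (Ne.symm hx.1), h.le_right⟩
  · rw [bspline_zero_of_not_inCell h, Set.indicator_of_notMem]
    rintro ⟨h1, h2⟩
    have h2 := lt_of_le_of_ne h2 hx.2
    rcases lt_or_ge x b with h' | h'
    · exact h (Or.inl ⟨h', h1.le, h2⟩)
    · exact h (Or.inr ⟨h', h1, h2.le⟩)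

lemma pow_mul_bspline_succ (m q i : ℕ) (x : ℝ) :
    x ^ m * bspline b ξ (q + 1) i x =
      (x ^ (m + 1) * bspline b ξ q i x - ξ i * (x ^ m * bspline b ξ q i x)) /
          (ξ (i + q + 1) - ξ i) +
        (ξ (i + q + 2) * (x ^ m * bspline b ξ q (i + 1) x) -
          x ^ (m + 1) * bspline b ξ q (i + 1) x) / (ξ (i + q + 2) - ξ (i + 1)) := by
  rw [bspline_succ]
  ring

lemma integrable_pow_mul_bspline (b : ℝ) (ξ : ℕ → ℝ) (q i m : ℕ) :
    Integrable (fun x => x ^ m * bspline b ξ q i x) := by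
  induction q generalizing i m with
  | zero =>
    have h1 : Integrable ((Set.Ioc (ξ i) (ξ (i + 1))).indicator fun x : ℝ => x ^ m) := by
      rw [integrable_indicator_iff measurableSet_Ioc]
      exact ((continuous_pow m).integrableOn_Icc).mono_set Set.Ioc_subset_Icc_self
    refine h1.congr ?_
    filter_upwards [bspline_zero_ae b ξ i] with x hx
    rw [hx]
    simp [Set.indicator]
  | succ q ih =>
    simp only [pow_mul_bspline_succ]
    exact (((ih i (m + 1)).sub ((ih i m).const_mul _)).div_const _).add
      ((((ih (i + 1) m).const_mul _).sub (ih (i + 1) (m + 1))).div_const _)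

lemma hsym_const_succ {t : ℝ} {m q i : ℕ} (h : ∀ k ≤ q + 1, ξ (i + k) = t) :
    (m + 1) * hsym ξ (m + 1) (q + 1) i = (m + q + 2) * (t * hsym ξ m (q + 1) i) := by
  have h1 := hsym_of_const h m
  have h2 := hsym_of_const h (m + 1)
  have h4 : ((m.factorial : ℝ) * (q + 1).factorial) ≠ 0 := by
    exact_mod_cast mul_ne_zero m.factorial_ne_zero (q + 1).factorial_ne_zero
  rw [show m + 1 + (q + 1) = (m + (q + 1)) + 1 by omega, Nat.factorial_succ (m + (q + 1)),
    Nat.factorial_succ m] at h2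
  push_cast at h2
  apply mul_right_cancel₀ h4
  linear_combination h2 - (m + q + 2) * t * h1

lemma mul_sub_div_eq {D X Y : ℝ} (h : D = 0 → X = Y) : (D * X - D * Y) / D = X - Y := by
  by_cases hD : D = 0
  · simp [hD, h hD]
  · field_simp

/-- The recursion multiplies by x, so the integral in degree q+1 involves first moments in degree q.
Treating all moments at once closes the induction. -/
lemma integral_pow_mul_bspline (hξ : Monotone ξ) (q i m : ℕ) :
    ∫ x, x ^ m * bspline b ξ q i x =
      (ξ (i + q + 1) - ξ i) * (hsym ξ m (q + 1) i * (m.factorial * q.factorial) /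
        (m + q + 1).factorial) := by
  induction q generalizing i m with
  | zero =>
    have h1 : ∫ x, x ^ m * bspline b ξ 0 i x =
        ∫ x, (Set.Ioc (ξ i) (ξ (i + 1))).indicator (fun x : ℝ => x ^ m) x := by
      refine integral_congr_ae ?_
      filter_upwards [bspline_zero_ae b ξ i] with x hx
      rw [hx]
      simp [Set.indicator]
    rw [h1, integral_indicator measurableSet_Ioc,
      ← intervalIntegral.integral_of_le (hξ (Nat.le_succ i)), integral_pow]
    have h2 : ∀ m i, hsym ξ m 0 i = ξ i ^ m := by
      intro m i
      induction m with
      | zero => simp [hsym]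
      | succ m ih => rw [hsym, ih, pow_succ']
    have h3 := hsym_succ_succ ξ m 0 i
    rw [hsym_succ_succ', h2, h2] at h3
    have h4 : (m.factorial : ℝ) ≠ 0 := by exact_mod_cast m.factorial_ne_zero
    have h5 : (m + 1 : ℝ) ≠ 0 := by positivity
    rw [add_zero, add_zero, Nat.factorial_succ, Nat.factorial_zero]
    push_cast
    field_simp
    simp only [add_zero, zero_add] at h3 ⊢
    linear_combination -h3
  | succ q ih =>
    simp only [pow_mul_bspline_succ]
    rw [integral_add, integral_div, integral_div, integral_sub, integral_sub,
      integral_const_mul, integral_const_mul, ih, ih, ih, ih]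
    rotate_left
    · exact (integrable_pow_mul_bspline ..).const_mul _
    · exact integrable_pow_mul_bspline ..
    · exact integrable_pow_mul_bspline ..
    · exact (integrable_pow_mul_bspline ..).const_mul _
    · exact ((integrable_pow_mul_bspline ..).sub
        ((integrable_pow_mul_bspline ..).const_mul _)).div_const _
    · exact (((integrable_pow_mul_bspline ..).const_mul _).sub
        (integrable_pow_mul_bspline ..)).div_const _
    have hF : ((m + q + 1).factorial : ℝ) ≠ 0 := by exact_mod_cast (m + q + 1).factorial_ne_zero
    have hF' : ((m + q + 2 : ℝ)) ≠ 0 := by positivity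
    have e1 : ((m + 1 + q + 1).factorial : ℝ) = (m + q + 2) * (m + q + 1).factorial := by
      rw [show m + 1 + q + 1 = (m + q + 1) + 1 by omega, Nat.factorial_succ]
      push_cast
      ring
    have e2 : ((m + (q + 1) + 1).factorial : ℝ) = (m + q + 2) * (m + q + 1).factorial := by
      rw [← e1]; congr 2; omega
    have e3 : ((m + 1).factorial : ℝ) = (m + 1) * m.factorial := by
      rw [Nat.factorial_succ]; push_cast; ring
    have e4 : ((q + 1).factorial : ℝ) = (q + 1) * q.factorial := by
      rw [Nat.factorial_succ]; push_cast; ring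
    -- When a support degenerates, its quotient is 0 by convention. The two terms left after
    -- cancelling the denominator must then agree, which holds because all knots involved coincide.
    have hconst : ∀ j, ξ (j + q + 1) - ξ j = 0 →
        (m + 1) * hsym ξ (m + 1) (q + 1) j = (m + q + 2) * (ξ j * hsym ξ m (q + 1) j) := by
      intro j hj
      refine hsym_const_succ fun k hk => ?_
      have h1 := hξ (show j ≤ j + k by omega)
      have h2 := hξ (show j + k ≤ j + q + 1 by omega)
      linarith
    rw [show ξ (i + q + 2) = ξ (i + 1 + q + 1) by congr 1; omega, mul_left_comm (ξ i),
      mul_left_comm (ξ (i + 1 + q + 1)), mul_sub_div_eq, mul_sub_div_eq, e1, e2, e3, e4,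
      show i + (q + 1) + 1 = i + 1 + q + 1 by omega]
    rotate_left
    · intro h
      have h5 := hconst _ h
      have h6 : ξ (i + 1 + q + 1) = ξ (i + 1) := by linarith
      rw [e1, e3, h6]
      field_simp
      linear_combination -h5
    · intro h
      have h5 := hconst _ h
      rw [e1, e3]
      field_simp
      linear_combination h5
    have a1 := hsym_succ_succ ξ m (q + 1) i
    have a2 := hsym_succ_succ' ξ m (q + 1) i
    rw [show i + (q + 1) + 1 = i + 1 + q + 1 by omega] at a2
    have a3 : ξ (i + 1 + q + 1) * hsym ξ m (q + 1) (i + 1) - ξ i * hsym ξ m (q + 1) i =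
        (ξ (i + 1 + q + 1) - ξ i) * hsym ξ m (q + 1 + 1) i := by
      cases m with
      | zero => simp [hsym]
      | succ m =>
        have b1 := hsym_succ_succ ξ m (q + 1) i
        have b2 := hsym_succ_succ' ξ m (q + 1) i
        rw [show i + (q + 1) + 1 = i + 1 + q + 1 by omega] at b2
        linear_combination ξ i * b2 - ξ (i + 1 + q + 1) * b1
    field_simp
    linear_combination (m + q + 2) * a3 + (m + 1) * (a1 - a2)

lemma integral_bspline (hξ : Monotone ξ) (b : ℝ) (q i : ℕ) :
    ∫ x, bspline b ξ q i x = (ξ (i + q + 1) - ξ i) / (q + 1) := by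
  have h := integral_pow_mul_bspline (b := b) hξ q i 0
  have h4 : (q.factorial : ℝ) ≠ 0 := by exact_mod_cast q.factorial_ne_zero
  simp only [pow_zero, one_mul, hsym, zero_add, Nat.factorial_succ, Nat.factorial_zero] at h
  rw [h]
  push_cast
  field_simp

end Moments

end KnotRemoval

/-! ### Splines over a basic knot vector: linear independence, coefficient norm, L² bound. -/

namespace KnotRemoval

lemma sum_Icc_one_eq_sum_range {M : Type*} [AddCommMonoid M] (f : ℕ → M) (n : ℕ) :
    ∑ i ∈ Finset.Icc 1 n, f i = ∑ i ∈ Finset.range n, f (i + 1) := by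
  induction n with
  | zero => simp
  | succ n ih => rw [Finset.sum_Icc_succ_top (by omega), ih, Finset.sum_range_succ]

lemma exists_lt_succ {f : ℕ → ℝ} {m n : ℕ} {x : ℝ} (hmn : m ≤ n) (h : f m ≤ x) (h' : x < f n) :
    ∃ j, m ≤ j ∧ j < n ∧ f j ≤ x ∧ x < f (j + 1) := by
  induction n, hmn using Nat.le_induction with
  | base => exact absurd h' (not_lt.2 h)
  | succ n hn ih =>
    rcases lt_or_ge x (f n) with h1 | h1
    · obtain ⟨j, h2, h3, h4⟩ := ih h1
      exact ⟨j, h2, h3.trans (Nat.lt_succ_self n), h4⟩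
    · exact ⟨n, hn, Nat.lt_succ_self n, h1, h'⟩

/-- The squared coefficient norm of the vector of control points `c₁, …, c_n`. -/
noncomputable def coeffSq (p : ℕ) (Ξ : KnotSeq) (c : ℕ → ℝ) : ℝ :=
  ∑ i ∈ Finset.Icc 1 Ξ.dim, c i ^ 2 * ((Ξ.knot (i + p + 1) - Ξ.knot i) / (p + 1))

/-- The knots of `Ξ`, extended by constants to a monotone sequence. -/
def monoKnot (p : ℕ) (Ξ : KnotSeq) (i : ℕ) : ℝ := Ξ.knot (max 1 (min i (Ξ.dim + p + 1)))

/-- The control points with respect to `ξ` of a spline given by its control points with respect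
to `ξ` without its element with index `i₀`. -/
noncomputable def insertCoeff (p : ℕ) (ξ : ℕ → ℝ) (i₀ : ℕ) (c : ℕ → ℝ) (i : ℕ) : ℝ :=
  insCoef p ξ i₀ i * c i + (1 - insCoef p ξ i₀ i) * c (i - 1)

variable {p : ℕ} {a b : ℝ} {Ξ : KnotSeq} {i i₀ j : ℕ} {x : ℝ} {s : ℝ → ℝ} {c c' : ℕ → ℝ}

lemma monoKnot_eq (h : 1 ≤ i) (h' : i ≤ Ξ.dim + p + 1) : monoKnot p Ξ i = Ξ.knot i := by
  rw [monoKnot, min_eq_left h', max_eq_right h]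

lemma IsBasic.knot_le (hΞ : IsBasic p a b Ξ) (hi : 1 ≤ i) (hij : i ≤ j)
    (hj : j ≤ Ξ.dim + p + 1) : Ξ.knot i ≤ Ξ.knot j := by
  induction j, hij using Nat.le_induction with
  | base => exact le_rfl
  | succ j hj' ih => exact (ih (by omega)).trans (hΞ.mono j (by omega) (by omega))

/-- The B-spline lemmas assume a globally monotone sequence, whereas the values of `knot` outside 1,
…, n+p+1 are arbitrary. Clamping the index repairs this without affecting B_1, …, B_n. -/
lemma IsBasic.monotone_monoKnot (hΞ : IsBasic p a b Ξ) : Monotone (monoKnot p Ξ) := by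
  intro i j hij
  exact hΞ.knot_le (by omega) (by omega) (by omega)

lemma bspline_monoKnot (hi : 1 ≤ i) (hi' : i ≤ Ξ.dim) (x : ℝ) :
    bspline b Ξ.knot p i x = bspline b (monoKnot p Ξ) p i x :=
  bspline_congr (fun r hr => (monoKnot_eq (by omega) (by omega)).symm) x

lemma spline_monoKnot (c : ℕ → ℝ) (x : ℝ) :
    spline p b Ξ c x = ∑ i ∈ Finset.Icc 1 Ξ.dim, c i * bspline b (monoKnot p Ξ) p i x :=
  Finset.sum_congr rfl fun i hi => by
    rw [Finset.mem_Icc] at hi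
    rw [bspline_monoKnot hi.1 hi.2]

/-- Equality would force p+2 equal knots, against the multiplicity bound. For i ≤ p+1 the support
already contains the step from ξ_{p+1} to ξ_{p+2}. -/
lemma IsBasic.knot_lt (hΞ : IsBasic p a b Ξ) (hi : 1 ≤ i) (hi' : i ≤ Ξ.dim) :
    Ξ.knot i < Ξ.knot (i + p + 1) := by
  rcases le_or_gt i (p + 1) with h | h
  · calc Ξ.knot i ≤ Ξ.knot (p + 1) := hΞ.knot_le hi h (by omega)
      _ < Ξ.knot (p + 2) := hΞ.left_lt
      _ ≤ _ := hΞ.knot_le (by omega) (by omega) (by omega)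
  refine lt_of_le_of_ne (hΞ.knot_le hi (by omega) (by omega)) fun h1 => ?_
  have h2 : Finset.Icc i (i + p + 1) ⊆
      (Finset.Icc 1 (Ξ.dim + p + 1)).filter (fun j => Ξ.knot j = Ξ.knot i) := by
    intro j hj
    rw [Finset.mem_Icc] at hj
    rw [Finset.mem_filter, Finset.mem_Icc]
    refine ⟨by omega, le_antisymm ?_ (hΞ.knot_le hi hj.1 (by omega))⟩
    rw [h1]
    exact hΞ.knot_le (by omega) hj.2 (by omega)
  have h3 := Finset.card_le_card h2
  have h4 := hΞ.mult_le i (by omega) hi'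
  rw [mult] at h4
  rw [Nat.card_Icc] at h3
  omega

/-- The support of B_i meets [a, b] in an interval of positive length, as independence on [a, b]
requires. -/
lemma IsBasic.knot_lt_of_interior (hΞ : IsBasic p a b Ξ) (hi : 1 ≤ i) (hi' : i ≤ Ξ.dim) :
    Ξ.knot (max i (p + 1)) < Ξ.knot (min (i + p) Ξ.dim + 1) := by
  have hn := hΞ.le_dim
  rcases le_or_gt i (p + 1) with h | h
  · rw [max_eq_right h]
    exact hΞ.left_lt.trans_le (hΞ.knot_le (by omega) (by omega) (by omega))
  · rw [max_eq_left h.le]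
    rcases le_or_gt (i + p) Ξ.dim with h' | h'
    · rw [min_eq_left h']
      exact hΞ.knot_lt hi hi'
    · rw [min_eq_right h'.le]
      exact (hΞ.knot_le (by omega) hi' (by omega)).trans_lt hΞ.lt_right

lemma sum_Icc_eq_sum_range_of_support {g : ℕ → ℝ} {n μ : ℕ} (h : p + 1 ≤ μ) (h' : μ ≤ n)
    (hg : ∀ i ≤ n, i + p < μ ∨ μ < i → g i = 0) :
    ∑ i ∈ Finset.Icc 1 n, g i = ∑ r ∈ Finset.range (p + 1), g (μ - p + r) := by
  have h1 := Finset.sum_Ico_eq_sum_range g (μ - p) (μ + 1)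
  rw [show μ + 1 - (μ - p) = p + 1 by omega] at h1
  rw [← h1]
  symm
  refine Finset.sum_subset (fun i hi => ?_) fun i hi hi' => ?_
  · rw [Finset.mem_Ico] at hi
    rw [Finset.mem_Icc]
    omega
  · rw [Finset.mem_Icc] at hi
    rw [Finset.mem_Ico] at hi'
    exact hg i hi.2 (by omega)

lemma IsBasic.sum_bspline_eq (hΞ : IsBasic p a b Ξ) {μ : ℕ} (h : p + 1 ≤ μ) (h' : μ ≤ Ξ.dim)
    (hx : InCell b (monoKnot p Ξ) μ x) (c : ℕ → ℝ) :
    ∑ i ∈ Finset.Icc 1 Ξ.dim, c i * bspline b (monoKnot p Ξ) p i x =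
      ∑ r ∈ Finset.range (p + 1),
        c (μ - p + r) * bspline b (monoKnot p Ξ) p (μ - p + r) x := by
  refine sum_Icc_eq_sum_range_of_support h h' fun i _ hi => ?_
  rcases hi with hi | hi
  · rw [bspline_eq_zero_of_lt_cell hΞ.monotone_monoKnot hx hi, mul_zero]
  · rw [bspline_eq_zero_of_cell_lt hΞ.monotone_monoKnot hx hi, mul_zero]

lemma IsBasic.exists_inCell (hΞ : IsBasic p a b Ξ) (hx : x ∈ Set.Icc a b) :
    ∃ μ, p + 1 ≤ μ ∧ μ ≤ Ξ.dim ∧ InCell b (monoKnot p Ξ) μ x := by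
  have hn := hΞ.le_dim
  rcases hx.2.lt_or_eq with h | rfl
  · obtain ⟨j, h1, h2, h3, h4⟩ := exists_lt_succ (f := monoKnot p Ξ) (m := p + 1)
      (n := Ξ.dim + 1) (x := x) (by omega)
      (by rw [monoKnot_eq (by omega) (by omega), hΞ.left]; exact hx.1)
      (by rw [monoKnot_eq (by omega) (by omega), hΞ.right]; exact h)
    exact ⟨j, h1, by omega, Or.inl ⟨h, h3, h4⟩⟩
  -- The point b belongs to the last interval (ξ_n, ξ_{n+1}] because of the left-continuous
  -- convention there.
  · refine ⟨Ξ.dim, hn, le_rfl, Or.inr ⟨le_rfl, ?_, ?_⟩⟩ <;>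
      rw [monoKnot_eq (by omega) (by omega)]
    · exact hΞ.right ▸ hΞ.lt_right
    · exact hΞ.right.ge

lemma IsBasic.sum_bspline_eq_one (hΞ : IsBasic p a b Ξ) (hx : x ∈ Set.Icc a b) :
    ∑ i ∈ Finset.Icc 1 Ξ.dim, bspline b (monoKnot p Ξ) p i x = 1 := by
  obtain ⟨μ, h1, h2, h3⟩ := hΞ.exists_inCell hx
  have h := hΞ.sum_bspline_eq h1 h2 h3 (fun _ => 1)
  simp only [one_mul] at h
  rw [h]
  exact sum_bspline_cell hΞ.monotone_monoKnot (by convert h3 using 1; omega)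

/-- Linear independence of the B-splines on `[a, b]`. -/
lemma IsBasic.coeff_eq_zero (hΞ : IsBasic p a b Ξ)
    (h : ∀ x ∈ Set.Icc a b, spline p b Ξ c x = 0) (hi : 1 ≤ i) (hi' : i ≤ Ξ.dim) : c i = 0 := by
  have hn := hΞ.le_dim
  -- Choose a nonempty knot interval of [a, b] inside the support of B_i; local independence on it
  -- gives c_i = 0.
  obtain ⟨μ, h1, h2, h3, h4⟩ := exists_lt_succ (f := Ξ.knot) (by omega) le_rfl
    (hΞ.knot_lt_of_interior hi hi')
  have h5 : Ξ.knot μ < Ξ.knot (μ + 1) := h3.trans_lt h4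
  have hb : Ξ.knot (μ + 1) ≤ b := hΞ.right ▸ hΞ.knot_le (by omega) (by omega) (by omega)
  have ha : a ≤ Ξ.knot μ := hΞ.left ▸ hΞ.knot_le (by omega) (by omega) (by omega)
  rw [← monoKnot_eq (p := p) (Ξ := Ξ) (i := μ) (by omega) (by omega)] at h5 ha
  rw [← monoKnot_eq (p := p) (Ξ := Ξ) (i := μ + 1) (by omega) (by omega)] at h5 hb
  have hμ : μ - p + p = μ := by omega
  have key := coeff_eq_zero_of_cell (b := b) (ξ := monoKnot p Ξ) (i := μ - p) (q := p) (c := c)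
    hΞ.monotone_monoKnot (by rwa [hμ]) (by rwa [hμ]) fun x hx => by
      rw [hμ] at hx
      rw [← hΞ.sum_bspline_eq (by omega) (by omega) hx, ← spline_monoKnot]
      exact h x ⟨ha.trans hx.le_left, hx.le_right.trans hb⟩
  have := key (i - (μ - p)) (by omega)
  rwa [show μ - p + (i - (μ - p)) = i by omega] at this

lemma spline_sub (c c' : ℕ → ℝ) :
    spline p b Ξ (c - c') = spline p b Ξ c - spline p b Ξ c' := by
  funext x
  simp only [spline, Pi.sub_apply, sub_mul, Finset.sum_sub_distrib]

lemma isControlPoints_spline (c : ℕ → ℝ) : IsControlPoints p a b Ξ (spline p b Ξ c) c :=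
  fun _ _ => rfl

lemma IsControlPoints.sub {t : ℝ → ℝ} (hs : IsControlPoints p a b Ξ s c)
    (ht : IsControlPoints p a b Ξ t c') : IsControlPoints p a b Ξ (s - t) (c - c') := by
  intro x hx
  rw [spline_sub, Pi.sub_apply, Pi.sub_apply, hs hx, ht hx]

lemma IsControlPoints.eq (hΞ : IsBasic p a b Ξ) (h : IsControlPoints p a b Ξ s c)
    (h' : IsControlPoints p a b Ξ s c') (hi : 1 ≤ i) (hi' : i ≤ Ξ.dim) : c i = c' i := by
  have := hΞ.coeff_eq_zero (c := c - c') (fun x hx => by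
    rw [spline_sub, Pi.sub_apply, ← h hx, ← h' hx, sub_self]) hi hi'
  rw [Pi.sub_apply] at this
  linarith

/-- `controlPoints` is an arbitrary choice; linear independence allows any vector of control points
in its place. -/
lemma IsBasic.xiNorm_eq (hΞ : IsBasic p a b Ξ) (hs : IsControlPoints p a b Ξ s c) :
    xiNorm p a b Ξ s = √(coeffSq p Ξ c) := by
  have h : ∃ c, IsControlPoints p a b Ξ s c := ⟨c, hs⟩
  have h1 : IsControlPoints p a b Ξ s (controlPoints p a b Ξ s) := by
    rw [controlPoints, dif_pos h]
    exact h.choose_spec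
  rw [xiNorm, coeffSq]
  congr 1
  refine Finset.sum_congr rfl fun i hi => ?_
  rw [Finset.mem_Icc] at hi
  rw [h1.eq hΞ hs hi.1 hi.2]

lemma IsBasic.coeffSq_nonneg (hΞ : IsBasic p a b Ξ) (c : ℕ → ℝ) : 0 ≤ coeffSq p Ξ c :=
  Finset.sum_nonneg fun i hi => by
    rw [Finset.mem_Icc] at hi
    have := hΞ.knot_lt hi.1 hi.2
    exact mul_nonneg (sq_nonneg _) (div_nonneg (by linarith) (by positivity))

/-- The `L²` norm of a spline is at most its coefficient norm. -/
lemma IsBasic.eLpNorm_le_xiNorm (hΞ : IsBasic p a b Ξ) (hs : s ∈ splineSpace p a b Ξ) :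
    eLpNorm s 2 (volume.restrict (Set.Icc a b)) ≤ ENNReal.ofReal (xiNorm p a b Ξ s) := by
  obtain ⟨c, hc⟩ := hs
  -- By Jensen with weights B_i(x), s² ≤ `G` on [a, b]. The integral of `G` over the whole line is
  -- the squared coefficient norm, and since `G` ≥ 0 restricting to [a, b] can only decrease it.
  let G : ℝ → ℝ := fun x => ∑ i ∈ Finset.Icc 1 Ξ.dim, c i ^ 2 * bspline b (monoKnot p Ξ) p i x
  have hB : ∀ i, Integrable (bspline b (monoKnot p Ξ) p i) := fun i => by
    simpa using integrable_pow_mul_bspline b (monoKnot p Ξ) p i 0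
  have hG : Integrable G := integrable_finsetSum _ fun i _ => (hB i).const_mul _
  have hG0 : ∀ x, 0 ≤ G x := fun x => Finset.sum_nonneg fun i _ =>
    mul_nonneg (sq_nonneg _) (bspline_nonneg hΞ.monotone_monoKnot b p i x)
  have hint : ∫ x, G x = coeffSq p Ξ c := by
    rw [integral_finsetSum _ fun i _ => (hB i).const_mul _, coeffSq]
    refine Finset.sum_congr rfl fun i hi => ?_
    rw [Finset.mem_Icc] at hi
    rw [integral_const_mul, integral_bspline hΞ.monotone_monoKnot,
      monoKnot_eq (by omega) (by omega), monoKnot_eq (by omega) (by omega)]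
  have hle : ∀ x ∈ Set.Icc a b, s x ^ 2 ≤ G x := by
    intro x hx
    rw [hc hx, spline_monoKnot]
    have := Real.pow_arith_mean_le_arith_mean_pow_of_even (Finset.Icc 1 Ξ.dim)
      (fun i => bspline b (monoKnot p Ξ) p i x) c
      (fun i _ => bspline_nonneg hΞ.monotone_monoKnot b p i x) (hΞ.sum_bspline_eq_one hx) even_two
    simpa only [G, mul_comm] using this
  rw [hΞ.xiNorm_eq hc, eLpNorm_eq_lintegral_rpow_enorm_toReal (by simp) (by simp),
    Real.sqrt_eq_rpow,
    ← ENNReal.ofReal_rpow_of_nonneg (hΞ.coeffSq_nonneg c) (by norm_num)]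
  simp only [ENNReal.toReal_ofNat]
  refine ENNReal.rpow_le_rpow ?_ (by norm_num)
  rw [← hint, ofReal_integral_eq_lintegral_ofReal hG (Filter.Eventually.of_forall hG0)]
  refine le_trans (setLIntegral_mono' measurableSet_Icc fun x hx => ?_)
    (setLIntegral_le_lintegral _ _)
  rw [← ofReal_norm, ENNReal.ofReal_rpow_of_nonneg (norm_nonneg _) (by norm_num)]
  refine ENNReal.ofReal_le_ofReal ?_
  rw [Real.rpow_two, Real.norm_eq_abs, sq_abs]
  exact hle x hx

/-! ### Knot insertion for coefficients and for weights. -/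

lemma sum_insertCoeff_mul {ξ : ℕ → ℝ} {n : ℕ} (h : p + 2 ≤ i₀) (h' : i₀ ≤ n) (c w : ℕ → ℝ) :
    ∑ i ∈ Finset.Icc 1 n, insertCoeff p ξ i₀ c i * w i =
      ∑ i ∈ Finset.Icc 1 (n - 1),
        c i * (insCoef p ξ i₀ i * w i + (1 - insCoef p ξ i₀ (i + 1)) * w (i + 1)) := by
  obtain ⟨m, rfl⟩ : ∃ m, n = m + 1 := ⟨n - 1, by omega⟩
  simp only [sum_Icc_one_eq_sum_range, insertCoeff, add_mul, mul_add, Finset.sum_add_distrib,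
    Nat.add_sub_cancel]
  -- The terms left over by the index shift vanish because λ_n = 0 and λ_1 = 1.
  rw [Finset.sum_range_succ, Finset.sum_range_succ' (fun i => _ * c i * w (i + 1)),
    insCoef_of_ge h', insCoef_of_le (i := 0 + 1) (by omega)]
  simp only [zero_mul, sub_self, add_zero]
  congr 1 <;> exact Finset.sum_congr rfl fun i _ => by ring

lemma IsBasic.insCoef_mul (hΞ : IsBasic p a b Ξ) (h : i₀ ≤ i + p + 1) (h' : i ≤ i₀)
    (hi : 1 ≤ i) (hi' : i ≤ Ξ.dim) :
    insCoef p Ξ.knot i₀ i * (Ξ.knot (i + p + 1) - Ξ.knot i) = Ξ.knot i₀ - Ξ.knot i := by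
  have := (sub_pos.2 (hΞ.knot_lt hi hi')).ne'
  rcases h.lt_or_eq with h | rfl
  · rcases h'.lt_or_eq with h' | rfl
    · rw [insCoef_of_mid h h', div_mul_cancel₀ _ this]
    · rw [insCoef_of_ge le_rfl, zero_mul, sub_self]
  · rw [insCoef_of_le le_rfl, one_mul]

lemma IsBasic.insCoef_mem (hΞ : IsBasic p a b Ξ) (hi : 1 ≤ i)
    (hi' : i ≤ Ξ.dim) : 0 ≤ insCoef p Ξ.knot i₀ i ∧ insCoef p Ξ.knot i₀ i ≤ 1 := by
  rcases le_or_gt (i + p + 1) i₀ with h1 | h1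
  · rw [insCoef_of_le h1]; norm_num
  rcases le_or_gt i₀ i with h2 | h2
  · rw [insCoef_of_ge h2]; norm_num
  rw [insCoef_of_mid h1 h2]
  have h3 := hΞ.knot_le hi h2.le (by omega)
  have h4 := hΞ.knot_le (i := i₀) (by omega) h1.le (by omega)
  have h5 := hΞ.knot_lt hi hi'
  exact ⟨div_nonneg (by linarith) (by linarith), (div_le_one (by linarith)).2 (by linarith)⟩

lemma IsBasic.bspline_remove (hΞ : IsBasic p a b Ξ) (h : p + 2 ≤ i₀) (h' : i₀ ≤ Ξ.dim)
    (hi : 1 ≤ i) (hi' : i + 1 ≤ Ξ.dim) :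
    bspline b (remove Ξ i₀).knot p i x =
      insCoef p Ξ.knot i₀ i * bspline b Ξ.knot p i x +
        (1 - insCoef p Ξ.knot i₀ (i + 1)) * bspline b Ξ.knot p (i + 1) x := by
  have h1 : ∀ j, 1 ≤ j → j ≤ Ξ.dim → insCoef p Ξ.knot i₀ j = insCoef p (monoKnot p Ξ) i₀ j := by
    intro j hj hj'
    rw [insCoef, insCoef, monoKnot_eq (by omega) (by omega), monoKnot_eq (by omega) (by omega),
      monoKnot_eq (by omega) (by omega)]
  rw [h1 i hi (by omega), h1 (i + 1) (by omega) hi', bspline_monoKnot (Ξ := Ξ) hi (by omega),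
    bspline_monoKnot (Ξ := Ξ) (by omega) hi', ← bspline_dropKnot hΞ.monotone_monoKnot]
  refine bspline_congr (fun r hr => ?_) x
  show dropKnot Ξ.knot i₀ (i + r) = _
  rw [dropKnot, dropKnot, monoKnot_eq (by omega) (by omega), monoKnot_eq (by omega) (by omega)]

/-- The integrated form of `IsBasic.bspline_remove`: the lengths of the supports satisfy the same
two-term relation as the B-splines. -/
lemma IsBasic.remove_knot_sub (hΞ : IsBasic p a b Ξ) (hi : 1 ≤ i) (hi' : i + 1 ≤ Ξ.dim) :
    (remove Ξ i₀).knot (i + p + 1) - (remove Ξ i₀).knot i =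
      insCoef p Ξ.knot i₀ i * (Ξ.knot (i + p + 1) - Ξ.knot i) +
        (1 - insCoef p Ξ.knot i₀ (i + 1)) * (Ξ.knot (i + 1 + p + 1) - Ξ.knot (i + 1)) := by
  show dropKnot Ξ.knot i₀ (i + p + 1) - dropKnot Ξ.knot i₀ i = _
  rcases lt_or_ge (i + p + 1) i₀ with h1 | h1
  · rw [dropKnot_of_lt h1, dropKnot_of_lt (by omega), insCoef_of_le (by omega),
      insCoef_of_le (by omega)]
    ring
  rcases le_or_gt i₀ i with h2 | h2
  · rw [dropKnot_of_le h1, dropKnot_of_le h2, insCoef_of_ge h2, insCoef_of_ge (by omega),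
      show i + 1 + p + 1 = i + p + 1 + 1 by omega]
    ring
  rw [dropKnot_of_le h1, dropKnot_of_lt h2, sub_mul, hΞ.insCoef_mul h1 h2.le hi (by omega),
    hΞ.insCoef_mul (by omega) h2 (by omega) hi', show i + 1 + p + 1 = i + p + 1 + 1 by omega]
  ring

lemma IsBasic.spline_remove (hΞ : IsBasic p a b Ξ) (h : p + 2 ≤ i₀) (h' : i₀ ≤ Ξ.dim)
    (c : ℕ → ℝ) :
    spline p b (remove Ξ i₀) c = spline p b Ξ (insertCoeff p Ξ.knot i₀ c) := by
  funext x
  rw [spline, spline, sum_insertCoeff_mul h h']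
  refine Finset.sum_congr rfl fun i hi => ?_
  rw [Finset.mem_Icc] at hi
  have : (remove Ξ i₀).dim = Ξ.dim - 1 := rfl
  rw [hΞ.bspline_remove h h' hi.1 (by omega)]

/-- Knot insertion does not increase the coefficient norm. -/
lemma IsBasic.coeffSq_insertCoeff_le (hΞ : IsBasic p a b Ξ) (h : p + 2 ≤ i₀) (h' : i₀ ≤ Ξ.dim)
    (c : ℕ → ℝ) :
    coeffSq p Ξ (insertCoeff p Ξ.knot i₀ c) ≤ coeffSq p (remove Ξ i₀) c := by
  have h1 : coeffSq p Ξ (insertCoeff p Ξ.knot i₀ c) ≤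
      ∑ i ∈ Finset.Icc 1 Ξ.dim, insertCoeff p Ξ.knot i₀ (fun j => c j ^ 2) i *
        ((Ξ.knot (i + p + 1) - Ξ.knot i) / (p + 1)) := by
    refine Finset.sum_le_sum fun i hi => ?_
    rw [Finset.mem_Icc] at hi
    have h2 := hΞ.knot_lt hi.1 hi.2
    obtain ⟨h3, h4⟩ := hΞ.insCoef_mem hi.1 hi.2
    refine mul_le_mul_of_nonneg_right ?_ (div_nonneg (by linarith) (by positivity))
    simp only [insertCoeff]
    -- Convexity of the square: λu² + (1-λ)v² - (λu + (1-λ)v)² = λ(1-λ)(u-v)².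
    have := mul_nonneg (mul_nonneg h3 (sub_nonneg.2 h4)) (sq_nonneg (c i - c (i - 1)))
    linarith
  refine h1.trans_eq ?_
  rw [sum_insertCoeff_mul h h', coeffSq]
  refine Finset.sum_congr rfl fun i hi => ?_
  rw [Finset.mem_Icc] at hi
  have : (remove Ξ i₀).dim = Ξ.dim - 1 := rfl
  rw [hΞ.remove_knot_sub hi.1 (by omega)]
  ring

end KnotRemoval

namespace KnotRemoval

variable {p : ℕ} {a b : ℝ} {Ξ : KnotSeq} {i i₀ : ℕ} {s : ℝ → ℝ} {c : ℕ → ℝ}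

/-! ### Removal of a knot and the shape of the insertion coefficients. -/

section Remove

lemma remove_dim (Ξ : KnotSeq) (i₀ : ℕ) : (remove Ξ i₀).dim = Ξ.dim - 1 := rfl

lemma remove_knot_of_lt (h : i < i₀) : (remove Ξ i₀).knot i = Ξ.knot i := if_pos h

lemma remove_knot_of_le (h : i₀ ≤ i) : (remove Ξ i₀).knot i = Ξ.knot (i + 1) :=
  if_neg (not_lt.2 h)

lemma mult_remove_le (h : 1 ≤ Ξ.dim) (z : ℝ) : mult p (remove Ξ i₀) z ≤ mult p Ξ z := by
  refine Finset.card_le_card_of_injOn (fun i => if i < i₀ then i else i + 1) (fun i hi => ?_)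
    fun i _ j _ hij => ?_
  · simp only [Finset.coe_filter, Set.mem_ofPred_eq, Finset.mem_Icc, remove_dim] at hi ⊢
    have h2 := hi.2
    split_ifs with h1
    · rw [remove_knot_of_lt h1] at h2
      exact ⟨by omega, h2⟩
    · rw [remove_knot_of_le (by omega)] at h2
      exact ⟨by omega, h2⟩
  · simp only at hij
    split_ifs at hij <;> omega

lemma IsBasic.isBasic_remove (hΞ : IsBasic p a b Ξ) (h : p + 2 ≤ i₀) (h' : i₀ ≤ Ξ.dim) :
    IsBasic p a b (remove Ξ i₀) where
  le_dim := by rw [remove_dim]; omega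
  mono := by
    intro i hi hi'
    rw [remove_dim] at hi'
    rcases lt_or_ge (i + 1) i₀ with h1 | h1
    · rw [remove_knot_of_lt h1, remove_knot_of_lt (by omega)]
      exact hΞ.knot_le hi (by omega) (by omega)
    · rw [remove_knot_of_le h1]
      rcases lt_or_ge i i₀ with h2 | h2
      · rw [remove_knot_of_lt h2]
        exact hΞ.knot_le hi (by omega) (by omega)
      · rw [remove_knot_of_le h2]
        exact hΞ.knot_le (by omega) (by omega) (by omega)
  left := by rw [remove_knot_of_lt (by omega), hΞ.left]
  right := by
    rw [remove_dim, remove_knot_of_le (by omega), ← hΞ.right]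
    congr 1; omega
  left_lt := by
    rw [remove_knot_of_lt (by omega)]
    refine hΞ.left_lt.trans_le ?_
    rcases lt_or_ge (p + 2) i₀ with h1 | h1
    · rw [remove_knot_of_lt h1]
    · rw [remove_knot_of_le h1]
      exact hΞ.knot_le (by omega) (by omega) (by omega)
  lt_right := by
    rw [remove_dim, remove_knot_of_le (i := Ξ.dim - 1 + 1) (by omega),
      show Ξ.dim - 1 + 1 + 1 = Ξ.dim + 1 by omega]
    refine lt_of_le_of_lt ?_ hΞ.lt_right
    rcases lt_or_ge (Ξ.dim - 1) i₀ with h1 | h1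
    · rw [remove_knot_of_lt h1]
      exact hΞ.knot_le (by omega) (by omega) (by omega)
    · rw [remove_knot_of_le h1, show Ξ.dim - 1 + 1 = Ξ.dim by omega]
  mult_le := by
    intro i hi hi'
    rw [remove_dim] at hi'
    refine (mult_remove_le (by omega) _).trans ?_
    rcases lt_or_ge i i₀ with h1 | h1
    · rw [remove_knot_of_lt h1]
      exact hΞ.mult_le i hi (by omega)
    · rw [remove_knot_of_le h1]
      exact hΞ.mult_le (i + 1) (by omega) (by omega)

lemma mem_removable : i ∈ removable p Ξ ↔ (p + 2 ≤ i ∧ i ≤ Ξ.dim) ∧ Ξ.knot i < Ξ.knot (i + 1) := by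
  rw [removable, Finset.mem_filter, Finset.mem_Icc]

lemma IsBasic.ell_le (hΞ : IsBasic p a b Ξ) (h : i₀ ∈ removable p Ξ) : ell p Ξ i₀ ≤ p := by
  obtain ⟨⟨h1, h2⟩, _⟩ := mem_removable.1 h
  have := hΞ.mult_le i₀ h1 h2
  rw [ell]
  omega

/-- The index i₀ is that of the last of ℓ+1 equal knots, so the copies occupy i₀-ℓ, …, i₀. Otherwise
all of them would have to fit into ℓ positions. -/
lemma IsBasic.knot_sub_ell (hΞ : IsBasic p a b Ξ) (h : i₀ ∈ removable p Ξ) :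
    Ξ.knot (i₀ - ell p Ξ i₀) = Ξ.knot i₀ := by
  have hℓ := hΞ.ell_le h
  obtain ⟨⟨h1, h2⟩, h3⟩ := mem_removable.1 h
  refine le_antisymm (hΞ.knot_le (by omega) (by omega) (by omega)) (not_lt.1 fun h4 => ?_)
  have hsub : (Finset.Icc 1 (Ξ.dim + p + 1)).filter (fun j => Ξ.knot j = Ξ.knot i₀) ⊆
      Finset.Icc (i₀ - ell p Ξ i₀ + 1) i₀ := by
    intro j hj
    rw [Finset.mem_filter, Finset.mem_Icc] at hj
    rw [Finset.mem_Icc]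
    constructor
    · by_contra h5
      have := hΞ.knot_le (i := j) (j := i₀ - ell p Ξ i₀) hj.1.1 (by omega) (by omega)
      linarith [hj.2]
    · by_contra h5
      have := hΞ.knot_le (i := i₀ + 1) (j := j) (by omega) (by omega) hj.1.2
      linarith [hj.2]
  have hpos : 0 < mult p Ξ (Ξ.knot i₀) := by
    refine Finset.card_pos.2 ⟨i₀, ?_⟩
    rw [Finset.mem_filter, Finset.mem_Icc]
    exact ⟨by omega, rfl⟩
  have h6 := Finset.card_le_card hsub
  rw [Nat.card_Icc] at h6
  have h7 : ell p Ξ i₀ = mult p Ξ (Ξ.knot i₀) - 1 := rfl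
  rw [mult] at hpos h7
  omega

/-- This is why the local system ends at row i₀-ℓ: from there on insertion is a mere index shift. -/
lemma IsBasic.insCoef_eq_zero (hΞ : IsBasic p a b Ξ) (h : i₀ ∈ removable p Ξ)
    (hi : i₀ - ell p Ξ i₀ ≤ i) : insCoef p Ξ.knot i₀ i = 0 := by
  have hℓ := hΞ.ell_le h
  have h1 := hΞ.knot_sub_ell h
  obtain ⟨⟨h2, h3⟩, _⟩ := mem_removable.1 h
  rcases le_or_gt i₀ i with h4 | h4
  · exact insCoef_of_ge h4
  · rw [insCoef_of_mid (by omega) h4]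
    have h5 := hΞ.knot_le (i := i₀ - ell p Ξ i₀) (j := i) (by omega) hi (by omega)
    have h6 := hΞ.knot_le (i := i) (j := i₀) (by omega) h4.le (by omega)
    rw [show Ξ.knot i₀ - Ξ.knot i = 0 by linarith, zero_div]

lemma IsBasic.alpha_eq (hΞ : IsBasic p a b Ξ) (h : i₀ ∈ removable p Ξ) {r : ℕ} (hr : r ≤ p + 1) :
    alpha p Ξ i₀ r = insCoef p Ξ.knot i₀ (i₀ - p - 1 + r) := by
  obtain ⟨⟨h2, h3⟩, _⟩ := mem_removable.1 h
  have h4 := hΞ.knot_lt (i := i₀ - p - 1 + r) (by omega) (by omega)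
  rw [alpha, div_eq_iff (by linarith), hΞ.insCoef_mul (by omega) (by omega) (by omega) (by omega)]

end Remove

/-! ### The local least squares problem solves the global one. -/

section LeastSquares

/-- A preimage of the orthogonal projection of y onto the range of M. Uniqueness is never needed,
since every least squares solution attains the indicator. -/
lemma exists_isLeastSquares {k m : ℕ} (M : Matrix (Fin k) (Fin m) ℝ) (y : Fin k → ℝ) :
    ∃ x, IsLeastSquares M y x := by
  let L : (Fin m → ℝ) →ₗ[ℝ] EuclideanSpace ℝ (Fin k) :=
    (WithLp.linearEquiv 2 ℝ (Fin k → ℝ)).symm.toLinearMap ∘ₗ M.mulVecLin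
  let Y : EuclideanSpace ℝ (Fin k) := WithLp.toLp 2 y
  have hL : ∀ z, (WithLp.toLp 2 (M.mulVec z - y) : EuclideanSpace ℝ (Fin k)) = L z - Y :=
    fun z => rfl
  obtain ⟨x, hx⟩ := (LinearMap.range L).starProjection_apply_mem Y
  refine ⟨x, fun z => ?_⟩
  rw [hL, hL, hx, norm_sub_rev, norm_sub_rev (L z), Submodule.starProjection_minimal]
  exact ciInf_le ⟨0, by rintro _ ⟨w, rfl⟩; exact norm_nonneg _⟩
    (⟨L z, LinearMap.mem_range_self L z⟩ : LinearMap.range L)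

lemma IsBasic.Aloc_mulVec (hΞ : IsBasic p a b Ξ) (h : i₀ ∈ removable p Ξ) (d : ℕ → ℝ)
    (r : Fin (p + 2 - ell p Ξ i₀)) :
    (Aloc p Ξ i₀).mulVec (fun t => d (i₀ - p - 1 + t)) r =
      insertCoeff p Ξ.knot i₀ d (i₀ - p - 1 + r) := by
  have hℓ := hΞ.ell_le h
  obtain ⟨⟨h2, h3⟩, _⟩ := mem_removable.1 h
  obtain ⟨r, hr⟩ := r
  simp only [Matrix.mulVec, dotProduct, Aloc, Matrix.of_apply]
  rw [Fin.sum_univ_eq_sum_range (fun t => (if t = r then alpha p Ξ i₀ r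
    else if t + 1 = r then 1 - alpha p Ξ i₀ r else 0) * d (i₀ - p - 1 + t))
    (p + 1 - ell p Ξ i₀), hΞ.alpha_eq h (by omega), insertCoeff]
  set α := insCoef p Ξ.knot i₀ (i₀ - p - 1 + r) with hα
  have e1 : ∀ t, (if t = r then α else if t + 1 = r then 1 - α else 0) * d (i₀ - p - 1 + t) =
      (if t = r then α * d (i₀ - p - 1 + t) else 0) +
        (if t + 1 = r then (1 - α) * d (i₀ - p - 1 + t) else 0) := by
    intro t
    split_ifs <;> first | omega | ring
  simp only [e1, Finset.sum_add_distrib]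
  congr 1
  · rw [Finset.sum_ite_eq']
    split_ifs with h4
    · rfl
    -- The last row, of index i₀-ℓ, has no diagonal entry in `Aloc`; its λ is 0.
    · rw [Finset.mem_range] at h4
      rw [hα, hΞ.insCoef_eq_zero h (by omega), zero_mul]
  · rcases r with _ | r
    -- The first row, of index i₀-p-1, has no subdiagonal entry; there 1 - λ = 0.
    · rw [hα, insCoef_of_le (by omega)]
      simp
    · simp only [Nat.add_right_cancel_iff]
      rw [Finset.sum_ite_eq', if_pos (Finset.mem_range.2 (by omega)),
        show i₀ - p - 1 + (r + 1) - 1 = i₀ - p - 1 + r by omega]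

lemma IsBasic.norm_residual_sq (hΞ : IsBasic p a b Ξ) (h : i₀ ∈ removable p Ξ) (c d : ℕ → ℝ) :
    ‖(WithLp.toLp 2 ((Eloc p Ξ i₀ * Aloc p Ξ i₀).mulVec (fun t => d (i₀ - p - 1 + t)) -
      (Eloc p Ξ i₀).mulVec (extractLoc p Ξ i₀ c)) :
        EuclideanSpace ℝ (Fin (p + 2 - ell p Ξ i₀)))‖ ^ 2 =
      ∑ i ∈ Finset.Ico (i₀ - p - 1) (i₀ - ell p Ξ i₀ + 1),
        (insertCoeff p Ξ.knot i₀ d - c) i ^ 2 *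
          ((Ξ.knot (i + p + 1) - Ξ.knot i) / (p + 1)) := by
  have hℓ := hΞ.ell_le h
  obtain ⟨⟨h2, h3⟩, _⟩ := mem_removable.1 h
  rw [Finset.sum_Ico_eq_sum_range,
    show i₀ - ell p Ξ i₀ + 1 - (i₀ - p - 1) = p + 2 - ell p Ξ i₀ by omega,
    EuclideanSpace.real_norm_sq_eq, Finset.sum_range]
  refine Finset.sum_congr rfl fun r _ => ?_
  have h4 := hΞ.knot_lt (i := i₀ - p - 1 + r) (by omega) (by omega)
  rw [← Matrix.mulVec_mulVec, PiLp.toLp_apply, Pi.sub_apply, Eloc, Matrix.mulVec_diagonal,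
    Matrix.mulVec_diagonal, hΞ.Aloc_mulVec h, ← mul_sub, mul_pow, weight,
    Real.sq_sqrt (div_nonneg (by linarith) (by positivity)), mul_comm]
  rfl

variable {x : Fin (p + 1 - ell p Ξ i₀) → ℝ}

lemma assemble_local (h : i₀ ∈ removable p Ξ) (t : Fin (p + 1 - ell p Ξ i₀)) :
    assemble p Ξ i₀ c x (i₀ - p - 1 + t) = x t := by
  obtain ⟨⟨h2, h3⟩, _⟩ := mem_removable.1 h
  have h4 : i₀ - p - 1 + (t : ℕ) - (i₀ - p - 1) = t := by omega
  rw [assemble, if_neg (by omega), dif_pos (by rw [h4]; exact t.2)]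
  congr 1
  exact Fin.ext h4

/-- The local least squares problem yields the global minimum of the coefficient norm of the
error. -/
lemma IsBasic.coeffSq_assemble_le (hΞ : IsBasic p a b Ξ) (h : i₀ ∈ removable p Ξ)
    (hx : IsLeastSquares (Eloc p Ξ i₀ * Aloc p Ξ i₀)
      ((Eloc p Ξ i₀).mulVec (extractLoc p Ξ i₀ c)) x) (d : ℕ → ℝ) :
    coeffSq p Ξ (insertCoeff p Ξ.knot i₀ (assemble p Ξ i₀ c x) - c) ≤
      coeffSq p Ξ (insertCoeff p Ξ.knot i₀ d - c) := by
  have hℓ := hΞ.ell_le h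
  obtain ⟨⟨h2, h3⟩, _⟩ := mem_removable.1 h
  have hsub : Finset.Ico (i₀ - p - 1) (i₀ - ell p Ξ i₀ + 1) ⊆ Finset.Icc 1 Ξ.dim := by
    intro i hi
    rw [Finset.mem_Ico] at hi
    rw [Finset.mem_Icc]
    omega
  have e1 : coeffSq p Ξ (insertCoeff p Ξ.knot i₀ (assemble p Ξ i₀ c x) - c) =
      ∑ i ∈ Finset.Ico (i₀ - p - 1) (i₀ - ell p Ξ i₀ + 1),
        (insertCoeff p Ξ.knot i₀ (assemble p Ξ i₀ c x) - c) i ^ 2 *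
          ((Ξ.knot (i + p + 1) - Ξ.knot i) / (p + 1)) := by
    refine (Finset.sum_subset hsub fun i hi hi' => ?_).symm
    rw [Finset.mem_Icc] at hi
    rw [Finset.mem_Ico] at hi'
    -- Outside the window the residual is 0: on the left λ = 1 and the coefficients are kept, on the
    -- right λ = 0 and the shift in `assemble` cancels that of insertion.
    have : insertCoeff p Ξ.knot i₀ (assemble p Ξ i₀ c x) i = c i := by
      rcases lt_or_ge (i + p + 1) i₀ with h4 | h4
      · rw [insertCoeff, insCoef_of_le h4.le, assemble, if_pos h4]
        ring
      · rw [insertCoeff, hΞ.insCoef_eq_zero h (by omega), assemble, assemble,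
          if_neg (c := i - 1 + p + 1 < i₀) (by omega),
          dif_neg (c := i - 1 - (i₀ - p - 1) < _) (by omega),
          show i - 1 + 1 = i by omega]
        ring
    rw [Pi.sub_apply, this, sub_self]
    ring
  have hx' : x = fun t : Fin (p + 1 - ell p Ξ i₀) =>
      assemble p Ξ i₀ c x (i₀ - p - 1 + t) := by
    funext t
    rw [assemble_local h]
  -- The window of any global competitor d competes in the local problem; the remaining terms of its
  -- error are nonnegative.
  have h5 := pow_le_pow_left₀ (norm_nonneg _) (hx fun t => d (i₀ - p - 1 + t)) 2
  rw [hΞ.norm_residual_sq h] at h5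
  nth_rw 1 [hx'] at h5
  rw [hΞ.norm_residual_sq h] at h5
  rw [e1]
  refine h5.trans (Finset.sum_le_sum_of_subset_of_nonneg hsub fun i hi _ => ?_)
  rw [Finset.mem_Icc] at hi
  have := hΞ.knot_lt hi.1 hi.2
  exact mul_nonneg (sq_nonneg _) (div_nonneg (by linarith) (by positivity))

lemma IsControlPoints.of_remove (hΞ : IsBasic p a b Ξ) (h : i₀ ∈ removable p Ξ)
    (hs : IsControlPoints p a b (remove Ξ i₀) s c) :
    IsControlPoints p a b Ξ s (insertCoeff p Ξ.knot i₀ c) := by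
  obtain ⟨⟨h2, h3⟩, _⟩ := mem_removable.1 h
  rw [IsControlPoints, ← hΞ.spline_remove h2 h3]
  exact hs

lemma IsBasic.splineSpace_remove_subset (hΞ : IsBasic p a b Ξ) (h : i₀ ∈ removable p Ξ) :
    splineSpace p a b (remove Ξ i₀) ⊆ splineSpace p a b Ξ := by
  rintro s ⟨c, hc⟩
  exact ⟨_, hc.of_remove hΞ h⟩

lemma IsBasic.xiNorm_le_xiNorm_remove (hΞ : IsBasic p a b Ξ) (h : i₀ ∈ removable p Ξ)
    (hs : s ∈ splineSpace p a b (remove Ξ i₀)) :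
    xiNorm p a b Ξ s ≤ xiNorm p a b (remove Ξ i₀) s := by
  obtain ⟨⟨h2, h3⟩, _⟩ := mem_removable.1 h
  obtain ⟨c, hc⟩ := hs
  rw [hΞ.xiNorm_eq (hc.of_remove hΞ h), (hΞ.isBasic_remove h2 h3).xiNorm_eq hc]
  exact Real.sqrt_le_sqrt (hΞ.coeffSq_insertCoeff_le h2 h3 c)

/-- The spline computed from the local least squares problem attains the error indicator. -/
lemma IsBasic.indicator_eq (hΞ : IsBasic p a b Ξ) (h : i₀ ∈ removable p Ξ)
    (hx : IsLeastSquares (Eloc p Ξ i₀ * Aloc p Ξ i₀)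
      ((Eloc p Ξ i₀).mulVec (extractLoc p Ξ i₀ c)) x) :
    indicator p a b Ξ (spline p b Ξ c) i₀ =
      xiNorm p a b Ξ (spline p b (remove Ξ i₀) (assemble p Ξ i₀ c x) -
        spline p b Ξ c) := by
  refine IsLeast.csInf_eq ⟨⟨_, ⟨_, isControlPoints_spline _⟩, rfl⟩, ?_⟩
  rintro _ ⟨g, ⟨d, hd⟩, rfl⟩
  simp only
  rw [hΞ.xiNorm_eq (((isControlPoints_spline _).of_remove hΞ h).sub (isControlPoints_spline c)),
    hΞ.xiNorm_eq ((hd.of_remove hΞ h).sub (isControlPoints_spline c))]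
  exact Real.sqrt_le_sqrt (hΞ.coeffSq_assemble_le h hx d)

end LeastSquares

/-! ### The triangle inequality for the coefficient norm. -/

section Norm

lemma sub_mem_splineSpace {t : ℝ → ℝ} (hs : s ∈ splineSpace p a b Ξ)
    (ht : t ∈ splineSpace p a b Ξ) : s - t ∈ splineSpace p a b Ξ := by
  obtain ⟨c, hc⟩ := hs
  obtain ⟨d, hd⟩ := ht
  exact ⟨_, hc.sub hd⟩

/-- Cauchy–Schwarz for the weighted coefficients c_i ω_i and d_i ω_i. -/
lemma IsBasic.sqrt_coeffSq_sub_le (hΞ : IsBasic p a b Ξ) (c d : ℕ → ℝ) :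
    √(coeffSq p Ξ (c - d)) ≤ √(coeffSq p Ξ c) + √(coeffSq p Ξ d) := by
  have hw : ∀ i ∈ Finset.Icc 1 Ξ.dim, weight p Ξ i ^ 2 =
      (Ξ.knot (i + p + 1) - Ξ.knot i) / (p + 1) := fun i hi => by
    rw [Finset.mem_Icc] at hi
    have := hΞ.knot_lt hi.1 hi.2
    rw [weight, Real.sq_sqrt (div_nonneg (by linarith) (by positivity))]
  have hsq : ∀ c, coeffSq p Ξ c = ∑ i ∈ Finset.Icc 1 Ξ.dim, (c i * weight p Ξ i) ^ 2 := fun c =>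
    Finset.sum_congr rfl fun i hi => by rw [mul_pow, hw i hi]
  have hCS := Finset.sum_mul_sq_le_sq_mul_sq (Finset.Icc 1 Ξ.dim) (fun i => c i * weight p Ξ i)
    (fun i => d i * weight p Ξ i)
  rw [← hsq c, ← hsq d] at hCS
  have h1 := Real.abs_le_sqrt hCS
  rw [Real.sqrt_mul (hΞ.coeffSq_nonneg c)] at h1
  refine Real.sqrt_le_iff.2 ⟨by positivity, ?_⟩
  have h2 : coeffSq p Ξ (c - d) = coeffSq p Ξ c + coeffSq p Ξ d -
      2 * ∑ i ∈ Finset.Icc 1 Ξ.dim, c i * weight p Ξ i * (d i * weight p Ξ i) := by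
    rw [hsq, hsq, hsq, Finset.mul_sum, ← Finset.sum_add_distrib, ← Finset.sum_sub_distrib]
    refine Finset.sum_congr rfl fun i _ => ?_
    rw [Pi.sub_apply]
    ring
  rw [h2, add_sq, Real.sq_sqrt (hΞ.coeffSq_nonneg c), Real.sq_sqrt (hΞ.coeffSq_nonneg d)]
  linarith [(abs_le.1 h1).1]

lemma IsBasic.xiNorm_sub_le (hΞ : IsBasic p a b Ξ) {t : ℝ → ℝ} (hs : s ∈ splineSpace p a b Ξ)
    (ht : t ∈ splineSpace p a b Ξ) :
    xiNorm p a b Ξ (s - t) ≤ xiNorm p a b Ξ s + xiNorm p a b Ξ t := by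
  obtain ⟨c, hc⟩ := hs
  obtain ⟨d, hd⟩ := ht
  rw [hΞ.xiNorm_eq hc, hΞ.xiNorm_eq hd, hΞ.xiNorm_eq (hc.sub hd)]
  exact hΞ.sqrt_coeffSq_sub_le c d

end Norm

/-! ### The loop invariant and termination. -/

section Algorithm

variable {tol : ℝ}

/-- The properties of a state `σ` that hold throughout the execution of the algorithm. -/
structure Invariant (p : ℕ) (a b tol : ℝ) (Ξ : KnotSeq) (s : ℝ → ℝ) (σ : State) : Prop where
  basic : IsBasic p a b σ.knots
  dim_add : σ.knots.dim + σ.iter = Ξ.dim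
  subset : splineSpace p a b σ.knots ⊆ splineSpace p a b Ξ
  xiNorm_le : ∀ g ∈ splineSpace p a b σ.knots, xiNorm p a b Ξ g ≤ xiNorm p a b σ.knots g
  tol_pos : 0 < σ.tol
  error_le : xiNorm p a b Ξ (s - spline p b σ.knots σ.coeff) ≤ tol - σ.tol

lemma Invariant.start (hΞ : IsBasic p a b Ξ) (hs : IsControlPoints p a b Ξ s c) (htol : 0 < tol) :
    Invariant p a b tol Ξ s (start tol Ξ c) where
  basic := hΞ
  dim_add := rfl
  subset := subset_rfl
  xiNorm_le := fun _ _ => le_rfl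
  tol_pos := htol
  error_le := by
    have h : xiNorm p a b Ξ (s - spline p b Ξ c) = 0 := by
      rw [hΞ.xiNorm_eq (hs.sub (isControlPoints_spline c))]
      simp [coeffSq]
    exact (h.trans (sub_self tol).symm).le

/-- The new error s_{k+1} - s_k has Ξ-norm at most its norm for the current knots, which is ε^(k),
exactly the amount deducted from the tolerance. -/
lemma Invariant.step (hΞ : IsBasic p a b Ξ) (hs : s ∈ splineSpace p a b Ξ) {kmax : ℕ}
    {σ τ : State} (hσ : Invariant p a b tol Ξ s σ) (hστ : Step p a b kmax σ τ) :
    Invariant p a b tol Ξ s τ := by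
  obtain ⟨⟨⟨j, hj, hjlt⟩, _⟩, i, hi, x, hx, hiter, htol, hknots, hcoeff⟩ := hστ
  have hB := hσ.basic
  obtain ⟨⟨h2, h3⟩, _⟩ := mem_removable.1 hi.1
  have heps : σ.eps p a b i = xiNorm p a b σ.knots
      (spline p b τ.knots τ.coeff - spline p b σ.knots σ.coeff) := by
    rw [hknots, hcoeff]
    exact hB.indicator_eq hi.1 hx
  have hsub : splineSpace p a b τ.knots ⊆ splineSpace p a b σ.knots := by
    rw [hknots]
    exact hB.splineSpace_remove_subset hi.1
  have hmemσ : spline p b σ.knots σ.coeff ∈ splineSpace p a b σ.knots :=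
    ⟨_, isControlPoints_spline _⟩
  have hmemτ : spline p b τ.knots τ.coeff ∈ splineSpace p a b τ.knots :=
    ⟨_, isControlPoints_spline _⟩
  have hdiff := sub_mem_splineSpace (hsub hmemτ) hmemσ
  refine ⟨?_, ?_, hsub.trans hσ.subset, fun g hg => ?_, ?_, ?_⟩
  · rw [hknots]
    exact hB.isBasic_remove h2 h3
  · have := hσ.dim_add
    rw [hknots, remove_dim, hiter]
    omega
  · refine (hσ.xiNorm_le g (hsub hg)).trans ?_
    rw [hknots] at hg ⊢
    exact hB.xiNorm_le_xiNorm_remove hi.1 hg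
  -- The loop condition speaks of some minimizer j, possibly not the chosen i; minimality of i
  -- transfers the strict bound.
  · rw [htol]
    linarith [hi.2 j hj.1]
  · have h4 := hΞ.xiNorm_sub_le (sub_mem_splineSpace hs (hσ.subset hmemσ)) (hσ.subset hdiff)
    -- (s - s_k) - (s_{k+1} - s_k) = s - s_{k+1}.
    rw [sub_sub_sub_cancel_right] at h4
    linarith [hσ.error_le, hσ.xiNorm_le _ hdiff]

lemma IsExecution.iter_eq {K : ℕ} {σ : ℕ → State} (h : IsExecution p a b tol Ξ c K σ) {k : ℕ}
    (hk : k ≤ K) : (σ k).iter = k := by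
  induction k with
  | zero => rw [h.1]; rfl
  | succ k ih =>
    obtain ⟨_, i, _, x, _, hiter, _⟩ := h.2 k hk
    rw [hiter, ih (by omega)]

lemma IsExecution.le_kMax {K : ℕ} {σ : ℕ → State} (h : IsExecution p a b tol Ξ c K σ) :
    K ≤ kMax p Ξ := by
  rcases K with _ | K
  · exact Nat.zero_le _
  · have h1 := (h.2 K (Nat.lt_succ_self K)).1.2
    rw [h.iter_eq (Nat.le_succ K)] at h1
    exact h1

lemma IsExecution.invariant (hΞ : IsBasic p a b Ξ) (hs : IsControlPoints p a b Ξ s c)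
    (htol : 0 < tol) {K : ℕ} {σ : ℕ → State} (h : IsExecution p a b tol Ξ c K σ) {k : ℕ}
    (hk : k ≤ K) : Invariant p a b tol Ξ s (σ k) := by
  induction k with
  | zero => rw [h.1]; exact Invariant.start hΞ hs htol
  | succ k ih => exact (ih (by omega)).step hΞ ⟨c, hs⟩ (h.2 k hk)

lemma State.Continues.exists_step {kmax : ℕ} {σ : State} (h : σ.Continues p a b kmax) :
    ∃ τ, Step p a b kmax σ τ := by
  obtain ⟨i, hi, _⟩ := h.1
  obtain ⟨x, hx⟩ := exists_isLeastSquares (Eloc p σ.knots i * Aloc p σ.knots i)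
    ((Eloc p σ.knots i).mulVec (extractLoc p σ.knots i σ.coeff))
  exact ⟨⟨_, _, _, _⟩, h, i, hi, x, hx, rfl, rfl, rfl, rfl⟩

lemma IsExecution.extend {K : ℕ} {σ : ℕ → State} (h : IsExecution p a b tol Ξ c K σ) {τ : State}
    (hτ : Step p a b (kMax p Ξ) (σ K) τ) :
    IsExecution p a b tol Ξ c (K + 1) (fun k => if k ≤ K then σ k else τ) := by
  refine ⟨by simpa using h.1, fun k hk => ?_⟩
  rcases (Nat.lt_succ_iff.1 hk).lt_or_eq with h1 | rfl
  · simp only [if_pos h1.le, if_pos (Nat.succ_le_of_lt h1)]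
    exact h.2 k h1
  · simpa using hτ

/-- If no execution ever stopped, each could be extended by one pass, giving one with more than
`kMax` passes. -/
lemma exists_returns (p : ℕ) (a b tol : ℝ) (Ξ : KnotSeq) (c : ℕ → ℝ) :
    ∃ (K : ℕ) (Ξ' : KnotSeq) (c' : ℕ → ℝ), Returns p a b tol Ξ c K Ξ' c' := by
  by_contra hne
  have key : ∀ K, ∃ σ, IsExecution p a b tol Ξ c K σ := by
    intro K
    induction K with
    | zero => exact ⟨fun _ => KnotRemoval.start tol Ξ c, rfl, fun k hk =>
        absurd hk (Nat.not_lt_zero k)⟩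
    | succ K ih =>
      obtain ⟨σ, hσ⟩ := ih
      have hcont : (σ K).Continues p a b (kMax p Ξ) := by
        by_contra h
        exact hne ⟨K, _, _, σ, hσ, h, rfl, rfl⟩
      obtain ⟨τ, hτ⟩ := hcont.exists_step
      exact ⟨_, hσ.extend hτ⟩
  obtain ⟨σ, hσ⟩ := key (kMax p Ξ + 1)
  exact absurd hσ.le_kMax (by omega)

end Algorithm

end KnotRemoval

theorem theorem6 (p : ℕ) (a b : ℝ) (Ξ : KnotRemoval.KnotSeq)
    (hΞ : KnotRemoval.IsBasic p a b Ξ) (s : ℝ → ℝ) (c : ℕ → ℝ)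
    (hs : KnotRemoval.IsControlPoints p a b Ξ s c) (tol : ℝ) (htol : 0 < tol) :
    -- every execution makes at most `k_max` passes through the loop and never gets stuck
    (∀ (K : ℕ) (σ : ℕ → KnotRemoval.State),
      KnotRemoval.IsExecution p a b tol Ξ c K σ →
        K ≤ KnotRemoval.kMax p Ξ ∧
        ((σ K).Continues p a b (KnotRemoval.kMax p Ξ) →
          ∃ τ, KnotRemoval.Step p a b (KnotRemoval.kMax p Ξ) (σ K) τ)) ∧
    -- so the algorithm stops and returns a result
    (∃ (K : ℕ) (Ξ' : KnotRemoval.KnotSeq) (c' : ℕ → ℝ),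
      KnotRemoval.Returns p a b tol Ξ c K Ξ' c') ∧
    -- every result is a spline in a coarser spline space, with the error bounds
    (∀ (K : ℕ) (Ξ' : KnotRemoval.KnotSeq) (c' : ℕ → ℝ),
      KnotRemoval.Returns p a b tol Ξ c K Ξ' c' →
        KnotRemoval.IsBasic p a b Ξ' ∧ Ξ'.dim + K = Ξ.dim ∧
        KnotRemoval.splineSpace p a b Ξ' ⊆ KnotRemoval.splineSpace p a b Ξ ∧
        KnotRemoval.spline p b Ξ' c' ∈ KnotRemoval.splineSpace p a b Ξ' ∧
        s - KnotRemoval.spline p b Ξ' c' ∈ KnotRemoval.splineSpace p a b Ξ ∧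
        MeasureTheory.eLpNorm (s - KnotRemoval.spline p b Ξ' c') 2
            (MeasureTheory.volume.restrict (Set.Icc a b)) ≤
          ENNReal.ofReal (KnotRemoval.xiNorm p a b Ξ (s - KnotRemoval.spline p b Ξ' c')) ∧
        KnotRemoval.xiNorm p a b Ξ (s - KnotRemoval.spline p b Ξ' c') < tol) := by
  refine ⟨fun K σ hσ => ⟨hσ.le_kMax, fun h => h.exists_step⟩,
    KnotRemoval.exists_returns p a b tol Ξ c, ?_⟩
  rintro K Ξ' c' ⟨σ, hσ, _, rfl, rfl⟩
  have hinv := hσ.invariant hΞ hs htol le_rfl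
  have hmem : KnotRemoval.spline p b (σ K).knots (σ K).coeff ∈
      KnotRemoval.splineSpace p a b (σ K).knots := ⟨_, KnotRemoval.isControlPoints_spline _⟩
  have hdiff := KnotRemoval.sub_mem_splineSpace ⟨c, hs⟩ (hinv.subset hmem)
  refine ⟨hinv.basic, ?_, hinv.subset, hmem, hdiff, hΞ.eLpNorm_le_xiNorm hdiff, ?_⟩
  · have := hinv.dim_add
    rwa [hσ.iter_eq le_rfl] at this
  -- The inequality is strict because a positive tolerance is left over at the end.
  · linarith [hinv.error_le, hinv.tol_pos]
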